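/- Let $T$ be a complete $\omega$-stable theory (over any countable parameter set in any model there are only countably many complete $n$-types, for each $n$). Let $M\models T$ be a monster model: $M$ is $\kappa$-saturated and strongly $\kappa$-homogeneous for some uncountable cardinal $\kappa$; "small" means of cardinality $<\kappa$. Work in $M^{eq}$: all elements, tuples, parameters, definable and type-definable sets may involve imaginaries. Type-definable sets are those type-definable over small sets. If $a$ is algebraic over $B$, let $m(a/B)$ be the finite number of realizations of $\mathrm{tp}(a/B)$. Suppose that $T$ is unimodular: for every small set $A$ and finite tuples $a,b$ with $\mathrm{tp}(a/A)=\mathrm{tp}(b/A)$ that are interalgebraic over $A$, one has $m(a/Ab)=m(b/Aa)$. For type-definable sets $X,Y$, a uniform correspondence between $X$ and $Y$ over a small set $A$ is a non-empty $A$-type-definable set $C\subseteq X\times Y$ for which there are $k_C,\ell_C\in\mathbb N$ with $|\{y:(x,y)\in C\}|=k_C$ for all $x\in X$ and $|\{x:(x,y)\in C\}|=\ell_C$ for all $y\in Y$; its ratio is $m_C=k_C/\ell_C$. Then: 1. ($T$ is correspondence unimodular for types.) For all type-definable sets $X,Y$ and all uniform correspondences $C_1,C_2$ between $X$ and $Y$,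 over any small sets of parameters, $m_{C_1}=m_{C_2}$. 2. ($T$ is functionally unimodular for types.) For all type-definable sets $X,Y$ with $Y\neq\emptyset$, if $f,g:X\to Y$ are (relatively) definable functions all of whose fibres over points of $Y$ have exactly $k$, respectively $\ell$, elements, where $k,\ell\in\mathbb N$, then $k=\ell$. 3. (All type-definable sets are measurable.) If $X$ is type-definable over a small set $A$ and $B\supseteq A$ is small, then every uniform correspondence $C$ between $X$ and $X$ over $B$ satisfies $k_C=\ell_C$. -/

import Mathlib

open FirstOrder Cardinal

universe u v w

namespace Unimod

section Imaginaries

variable (L : FirstOrder.Language.{u, v}) (M : Type w) [L.Structure M]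

/-- A sort of `M^eq`: a `∅`-definable equivalence relation on `M ^ n`. -/
structure ImSort where
  arity : ℕ
  rel : Setoid (Fin arity → M)
  definable : ∃ φ : L.Formula (Fin arity ⊕ Fin arity),
    ∀ v w : Fin arity → M, rel v w ↔ φ.Realize (Sum.elim v w)

variable {L M}

/-- The elements of a sort of `M^eq`. Real tuples are the elements of the sorts given by equality
on `M ^ n`, and a finite tuple of elements of sorts is an element of the product sort, so
"element of a sort" stands for "finite tuple of real or imaginary elements". -/
def ImSort.Elem (S : ImSort L M) : Type w := Quotient S.rel

/-- The class of a real tuple. -/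
def ImSort.cls (S : ImSort L M) (v : Fin S.arity → M) : S.Elem := Quotient.mk S.rel v

/-- The class of a pair of real tuples, in a product of two sorts. -/
def ImSort.clsPair (S S' : ImSort L M) (v : Fin S.arity ⊕ Fin S'.arity → M) : S.Elem × S'.Elem :=
  (S.cls fun i => v (Sum.inl i), S'.cls fun j => v (Sum.inr j))

variable (L M) in
/-- `M^eq`, the disjoint union of all its sorts. -/
def Meq : Type w := Σ S : ImSort L M, S.Elem

/-- A set of real tuples is definable over a set `A` of elements of `M^eq` if it is `φ(x, e)` for
a finite tuple `e` from `A`; the formula `φ` gets real representatives of `e` as parameters,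
and the choice of the representatives must not matter. -/
def RealDefinableOver (A : Set (Meq L M)) {ι : Type} (P : Set (ι → M)) : Prop :=
  ∃ (m : ℕ) (e : Fin m → Meq L M), (∀ i, e i ∈ A) ∧
    ∃ φ : L.Formula (ι ⊕ (Σ i : Fin m, Fin (e i).1.arity)),
      ∀ (v : ι → M) (w : ∀ i : Fin m, Fin (e i).1.arity → M),
        (∀ i, (e i).1.cls (w i) = (e i).2) →
          (v ∈ P ↔ φ.Realize (Sum.elim v fun ij => w ij.1 ij.2))

/-- Let `q` be the canonical surjection from real tuples onto a sort (`S.cls`) or onto a product of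
two sorts (`S.clsPair S'`). A set of elements is `A`-definable in `M^eq` if its preimage under `q`,
a set of real tuples, is `A`-definable. -/
def DefinableOver (A : Set (Meq L M)) {ι : Type} {Z : Type w} (q : (ι → M) → Z) (X : Set Z) :
    Prop :=
  RealDefinableOver A (q ⁻¹' X)

/-- Type-definable over `A`: an intersection of `A`-definable sets. -/
def TypeDefinableOver (A : Set (Meq L M)) {ι : Type} {Z : Type w} (q : (ι → M) → Z)
    (X : Set Z) : Prop :=
  ∃ F : Set (Set Z), (∀ D ∈ F, DefinableOver A q D) ∧ X = ⋂₀ F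

/-- `tp(a / A) = tp(b / A)`. -/
def TypeEq (A : Set (Meq L M)) {S : ImSort L M} (a b : S.Elem) : Prop :=
  ∀ X : Set S.Elem, DefinableOver A S.cls X → (a ∈ X ↔ b ∈ X)

/-- `a ∈ acl(A)`. -/
def AlgebraicOver (A : Set (Meq L M)) {S : ImSort L M} (a : S.Elem) : Prop :=
  ∃ X : Set S.Elem, DefinableOver A S.cls X ∧ X.Finite ∧ a ∈ X

/-- `A ∪ {b}`. -/
def adjoin (A : Set (Meq L M)) {S : ImSort L M} (b : S.Elem) : Set (Meq L M) :=
  insert (⟨S, b⟩ : Meq L M) A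

/-- `m(a / A)`, the number of realizations of `tp(a / A)`; used when `a` is algebraic
over `A`, so that this number is finite. -/
noncomputable def mult (A : Set (Meq L M)) {S : ImSort L M} (a : S.Elem) : ℕ :=
  {a' : S.Elem | TypeEq A a' a}.ncard

/-- `C` is a uniform correspondence between `X` and `Y` over `A`, with fibre sizes `k` and `l`
(and ratio `k / l`). -/
structure IsUniformCorrespondence (A : Set (Meq L M)) {S S' : ImSort L M}
    (X : Set S.Elem) (Y : Set S'.Elem) (C : Set (S.Elem × S'.Elem)) (k l : ℕ) : Prop where
  nonempty : C.Nonempty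
  typeDefinable : TypeDefinableOver A (S.clsPair S') C
  subset : C ⊆ X ×ˢ Y
  fibre_left : ∀ x ∈ X, {y | (x, y) ∈ C}.encard = k
  fibre_right : ∀ y ∈ Y, {x | (x, y) ∈ C}.encard = l

/-- `X` is measurable over `A`: all uniform correspondences on `X` over `A` are balanced. -/
def MeasurableOver (A : Set (Meq L M)) {S : ImSort L M} (X : Set S.Elem) : Prop :=
  ∀ (C : Set (S.Elem × S.Elem)) (k l : ℕ), IsUniformCorrespondence A X X C k l → k = l

/-- `f` restricts to a definable function `X → Y`, that is, its graph on `X` is the trace on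
`X × Y` of a set definable with parameters. -/
def IsDefinableMap {S S' : ImSort L M} (X : Set S.Elem) (Y : Set S'.Elem)
    (f : S.Elem → S'.Elem) : Prop :=
  Set.MapsTo f X Y ∧ ∃ D : Set (S.Elem × S'.Elem),
    DefinableOver (Set.univ : Set (Meq L M)) (S.clsPair S') D ∧ ∀ x ∈ X, ∀ y ∈ Y, (x, y) ∈ D ↔ f x = y

/-- All fibres over `Y` of the restriction of `f` to `X` have exactly `k` elements. -/
def HasFibreSize {S S' : ImSort L M} (X : Set S.Elem) (Y : Set S'.Elem)
    (f : S.Elem → S'.Elem) (k : ℕ) : Prop :=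
  ∀ y ∈ Y, {x | x ∈ X ∧ f x = y}.encard = k

end Imaginaries

section Monster

/-- `M` is a monster model with smallness bound `κ`: the cardinal `κ` is uncountable, `M` is
`κ`-saturated, and `M` is strongly `κ`-homogeneous. -/
structure IsMonster (L : FirstOrder.Language.{u, v}) (M : Type w) [L.Structure M]
    (κ : Cardinal.{w}) : Prop where
  uncountable : ℵ₀ < κ
  saturated : ∀ (A : Set M), #A < κ → ∀ (n : ℕ) (Γ : Set (L[[A]].Formula (Fin n))),
    (∀ Δ : Set (L[[A]].Formula (Fin n)), Δ ⊆ Γ → Δ.Finite →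
      ∃ v : Fin n → M, ∀ φ ∈ Δ, φ.Realize v) →
    ∃ v : Fin n → M, ∀ φ ∈ Γ, φ.Realize v
  homogeneous : ∀ (A : Set M), #A < κ → ∀ f : A → M,
    (∀ φ : L.Formula A, φ.Realize (fun a : A => (a : M)) ↔ φ.Realize f) →
    ∃ σ : M ≃[L] M, ∀ a : A, σ a = f a

/-- `T` is `ω`-stable: there are only countably many complete `n`-types over any countable set of
parameters in any model of `T`. -/
def IsOmegaStable {L : FirstOrder.Language.{u, v}} (T : L.Theory) : Prop :=
  ∀ (N : FirstOrder.Language.Theory.ModelType.{u, v, w} T) (A : Set N), A.Countable →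
    ∀ n : ℕ, Countable ((L[[A]].completeTheory N).CompleteType (Fin n))

variable (L : FirstOrder.Language.{u, v}) (M : Type w) [L.Structure M] (κ : Cardinal.{w})

/-- Unimodularity, evaluated in the monster model `M`. -/
def Unimodular : Prop :=
  ∀ (A : Set (Meq L M)), #A < κ → ∀ (S : ImSort L M) (a b : S.Elem),
    TypeEq A a b → AlgebraicOver (adjoin A b) a → AlgebraicOver (adjoin A a) b →
      mult (adjoin A b) a = mult (adjoin A a) b

variable {L M} in
/-- Type-definable sets of elements of a sort: over some small set of parameters. -/
def TypeDefinable {S : ImSort L M} (X : Set S.Elem) : Prop :=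
  ∃ A : Set (Meq L M), #A < κ ∧ TypeDefinableOver A S.cls X

/-- Correspondence unimodularity for types: two uniform correspondences (over possibly different
small sets of parameters) between the same two type-definable sets have the same ratio. -/
def CorrespondenceUnimodularForTypes : Prop :=
  ∀ (S S' : ImSort L M) (X : Set S.Elem) (Y : Set S'.Elem),
    TypeDefinable κ X → TypeDefinable κ Y →
    ∀ (A₁ A₂ : Set (Meq L M)), #A₁ < κ → #A₂ < κ →
    ∀ (C₁ C₂ : Set (S.Elem × S'.Elem)) (k₁ l₁ k₂ l₂ : ℕ),
      IsUniformCorrespondence A₁ X Y C₁ k₁ l₁ → IsUniformCorrespondence A₂ X Y C₂ k₂ l₂ →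
        (k₁ : ℚ) / l₁ = (k₂ : ℚ) / l₂

/-- Functional unimodularity for types: two definable functions between the same two type-definable
sets (the target being non-empty) with constant finite fibre sizes have the same fibre size. -/
def FunctionallyUnimodularForTypes : Prop :=
  ∀ (S S' : ImSort L M) (X : Set S.Elem) (Y : Set S'.Elem),
    TypeDefinable κ X → TypeDefinable κ Y → Y.Nonempty →
    ∀ (f g : S.Elem → S'.Elem) (k l : ℕ), IsDefinableMap X Y f → IsDefinableMap X Y g →
      HasFibreSize X Y f k → HasFibreSize X Y g l → k = l

/-- All partial types are measurable: each partial type over a small set `A` is measurable over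
each small set `B ⊇ A`. -/
def AllTypesMeasurable : Prop :=
  ∀ (S : ImSort L M) (X : Set S.Elem) (A : Set (Meq L M)), #A < κ → TypeDefinableOver A S.cls X →
    ∀ B : Set (Meq L M), A ⊆ B → #B < κ → MeasurableOver B X

end Monster

end Unimod

/-! Put all parameters into one small set `B` of real elements, choosing representatives of the
imaginary ones, and let `G` be the group of automorphisms of `M` over `B`. By homogeneity, the
complete types over `B` in a sort are the `G`-orbits, and the multiplicity of `a` over `B` and `b`
is the index of `stab a ∩ stab b` in `stab b`. Unimodularity then says that if the stabilizers of
`a` and of a conjugate `g • a` are commensurable, their intersection has the same index in both, so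
they have the same "Haar measure" (`Unimodular.relIndex_eq`).

Two uniform correspondences `C₁`, `C₂` form a locally finite `G`-invariant graph on the disjoint
union of `X` and `Y`. Edges join points with commensurable stabilizers, so on a piece that is
connected up to conjugation the weight `1 / μ(stab x)` is defined up to one scalar, and it is
`G`-invariant by unimodularity (`exists_weight`). If the piece has finitely many orbits, counting
the orbits of edges of `Cᵢ` from either end gives `w(X) * kᵢ = w(Y) * lᵢ`, where `w(X)` and `w(Y)`
are the total weights of the orbits on the two sides (`mass_transport`). Hence both ratios equal
`w(Y) / w(X)`.

Such a finite piece comes from `ω`-stability. Take a minimal nonempty closed set `K` stable under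
edges. The type spaces are scattered, so `K` has an isolated type. Isolation passes along edges
because the fibres have constant finite size (`IsMonster.isolated_of_correspondence`). By minimality
everything in `K` is reached from that type, so all types in `K` are isolated, and compactness
leaves finitely many (`exists_finite_component`).

The functional statement follows by comparing graphs of functions, and measurability by comparing a
correspondence with the diagonal. -/

namespace Unimod

/-! ### Commensurable stabilizers, mass transport and minimal closed sets for a group action. -/

section Groups

open MulAction

variable {G : Type*} [Group G]

/-- The ratio of the indices of two commensurable subgroups in their intersection, that is, the
ratio of their Haar measures. -/
noncomputable def indexRatio (H J : Subgroup G) : ℚ :=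
  (J.relIndex H : ℚ) / H.relIndex J

/-- Indices are multiplicative along `D ≤ H ⊓ J ≤ H` and `D ≤ H ⊓ J ≤ J`, and the common factor
cancels. Finite index in `J` is not needed: otherwise both denominators are the default value `0`,
and so are both quotients. -/
theorem indexRatio_eq_of_le {H J D : Subgroup G} (hH : D ≤ H) (hJ : D ≤ J)
    (h₁ : D.relIndex H ≠ 0) :
    indexRatio H J = (D.relIndex H : ℚ) / D.relIndex J := by
  have e₁ : D.relIndex (H ⊓ J) * J.relIndex H = D.relIndex H := by
    rw [← Subgroup.inf_relIndex_left H J]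
    exact Subgroup.relIndex_mul_relIndex _ _ _ (le_inf hH hJ) inf_le_left
  have e₂ : D.relIndex (H ⊓ J) * H.relIndex J = D.relIndex J := by
    rw [← Subgroup.inf_relIndex_right H J]
    exact Subgroup.relIndex_mul_relIndex _ _ _ (le_inf hH hJ) inf_le_right
  have h₀ : (D.relIndex (H ⊓ J) : ℚ) ≠ 0 := by
    intro h
    rw [Nat.cast_eq_zero] at h
    rw [h, zero_mul] at e₁
    exact h₁ e₁.symm
  rw [indexRatio, ← e₁, ← e₂]
  push_cast
  rw [mul_div_mul_left _ _ h₀]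

/-- All three ratios can be computed from the triple intersection, where the index in `J` cancels.
-/
theorem indexRatio_mul {H J N : Subgroup G} (h₁ : H.Commensurable J) (h₂ : J.Commensurable N) :
    indexRatio H J * indexRatio J N = indexRatio H N := by
  have h₃ := h₁.trans h₂
  have dH : (H ⊓ J ⊓ N).relIndex H ≠ 0 := by
    rw [inf_assoc, Subgroup.inf_relIndex_left]
    exact Subgroup.relIndex_inf_ne_zero h₁.2 h₃.2
  have dJ : (H ⊓ J ⊓ N).relIndex J ≠ 0 :=
    Subgroup.relIndex_inf_ne_zero (Subgroup.relIndex_inf_ne_zero h₁.1 (by simp)) h₂.2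
  rw [indexRatio_eq_of_le (inf_le_left.trans inf_le_left) (inf_le_left.trans inf_le_right) dH,
    indexRatio_eq_of_le (inf_le_left.trans inf_le_right) inf_le_right dJ,
    indexRatio_eq_of_le (inf_le_left.trans inf_le_left) inf_le_right dH]
  exact div_mul_div_cancel₀ (by exact_mod_cast dJ)

theorem indexRatio_pos {H J : Subgroup G} (h : H.Commensurable J) : 0 < indexRatio H J :=
  div_pos (by exact_mod_cast Nat.pos_of_ne_zero h.2) (by exact_mod_cast Nat.pos_of_ne_zero h.1)

variable {α β Z : Type*} [MulAction G α] [MulAction G β] [MulAction G Z]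

/-- Orbit-stabilizer for the action of `stab x`. An infinite orbit gives `0` on both sides. -/
theorem relIndex_stabilizer (x : α) (y : β) :
    (stabilizer G y).relIndex (stabilizer G x) = (orbit (stabilizer G x) y).ncard := by
  rw [← index_stabilizer, Subgroup.relIndex]
  congr 1

theorem relIndex_stabilizer_smul (g : G) (x : α) (y : β) :
    (stabilizer G (g • y)).relIndex (stabilizer G (g • x)) =
      (stabilizer G y).relIndex (stabilizer G x) := by
  rw [stabilizer_smul_eq_stabilizer_map_conj, stabilizer_smul_eq_stabilizer_map_conj]
  exact Subgroup.relIndex_map_map_of_injective _ _ (MulAut.conj g).injective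

/-- A finite set which meets each `G`-orbit in `K` in one point. -/
structure IsTransversal (G : Type*) [Group G] {α : Type*} [MulAction G α] (K : Set α)
    (R : Finset α) : Prop where
  subset : ↑R ⊆ K
  exists_mem : ∀ x ∈ K, ∃ g : G, g • x ∈ R
  eq_of_smul : ∀ x ∈ R, ∀ g : G, g • x ∈ R → g • x = x

theorem exists_isTransversal {K : Set α} (hK : ∀ x ∈ K, ∀ g : G, g • x ∈ K) {R₀ : Set α}
    (hR₀ : R₀.Finite) (h : ∀ x ∈ K, ∃ g : G, g • x ∈ R₀) : ∃ R, IsTransversal G K R := by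
  classical
  let τ : α → α := fun x => (Quotient.mk (orbitRel G α) x).out
  have hτ : ∀ x, ∃ g : G, g • x = τ x := fun x => Quotient.mk_out (s := orbitRel G α) x
  have hτ' : ∀ (g : G) x, τ (g • x) = τ x := fun g x => by
    have : Quotient.mk (orbitRel G α) (g • x) = Quotient.mk (orbitRel G α) x :=
      Quotient.sound ⟨g, rfl⟩
    simp only [τ, this]
  have hττ : ∀ x, τ (τ x) = τ x := fun x => by
    obtain ⟨g, hg⟩ := hτ x
    conv_lhs => rw [← hg, hτ']
  refine ⟨(hR₀.toFinset.image τ).filter (· ∈ K), ?_, ?_, ?_⟩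
  · intro x hx
    simp only [Finset.coe_filter, Set.mem_ofPred_eq] at hx
    exact hx.2
  · intro x hx
    obtain ⟨g, hg⟩ := h x hx
    obtain ⟨g', hg'⟩ := hτ (g • x)
    refine ⟨g' * g, ?_⟩
    rw [Finset.mem_filter, Finset.mem_image]
    refine ⟨⟨g • x, by simpa using hg, by rw [mul_smul, hg']⟩, hK _ hx _⟩
  · intro x hx g hg
    rw [Finset.mem_filter, Finset.mem_image] at hx hg
    obtain ⟨⟨y, -, rfl⟩, -⟩ := hx
    obtain ⟨⟨z, -, hz⟩, -⟩ := hg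
    rw [← hz, ← hττ z, hz, hτ', hττ]

/-- The left side is the weighted count of the edges that start in `R`. Grouping these edges by
`G`-orbit, the orbit of `t` contributes one edge for each point of the orbit of `t.2` under `stab
t.1`. -/
theorem sum_transversal_mul {K : Set α} {C : Set (α × β)}
    (hC : ∀ p ∈ C, ∀ g : G, g • p ∈ C) {R : Finset α} (hR : IsTransversal G K R)
    {T : Finset (α × β)} (hT : IsTransversal G (C ∩ {p | p.1 ∈ K}) T) {k : ℕ}
    (hk : ∀ x ∈ K, {y | (x, y) ∈ C}.encard = k) (u : α → ℚ)
    (hu : ∀ x ∈ K, ∀ g : G, u (g • x) = u x) :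
    (∑ x ∈ R, u x) * k =
      ∑ t ∈ T, u t.1 * (stabilizer G t.2).relIndex (stabilizer G t.1) := by
  classical
  have hfin : ∀ x ∈ K, {y | (x, y) ∈ C}.Finite := fun x hx =>
    Set.finite_of_encard_eq_coe (hk x hx)
  let N : α → Finset β := fun x => if h : x ∈ K then (hfin x h).toFinset else ∅
  have hN : ∀ x ∈ K, ∀ y, y ∈ N x ↔ (x, y) ∈ C := fun x hx y => by simp [N, hx]
  have hNk : ∀ x ∈ K, (N x).card = k := fun x hx => by
    have := hk x hx
    rw [(hfin x hx).encard_eq_coe_toFinset_card] at this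
    simpa [N, hx] using this
  let P : Finset (α × β) := R.biUnion fun x => (N x).image fun y => (x, y)
  have hP : ∀ p : α × β, p ∈ P ↔ p.1 ∈ R ∧ p.2 ∈ N p.1 := by
    rintro ⟨x, y⟩
    simp only [P, Finset.mem_biUnion, Finset.mem_image, Prod.mk.injEq]
    constructor
    · rintro ⟨a, ha, b, hb, rfl, rfl⟩
      exact ⟨ha, hb⟩
    · rintro ⟨h₁, h₂⟩
      exact ⟨x, h₁, y, h₂, rfl, rfl⟩
  have hPC : ∀ p ∈ P, p ∈ C ∩ {p | p.1 ∈ K} := fun p hp => by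
    have h := (hP p).1 hp
    exact ⟨(hN _ (hR.subset h.1) _).1 h.2, hR.subset h.1⟩
  have s₁ : (∑ x ∈ R, u x) * k = ∑ p ∈ P, u p.1 := by
    rw [Finset.sum_finset_product P R N hP, Finset.sum_mul]
    refine Finset.sum_congr rfl fun x hx => ?_
    simp [hNk x (hR.subset hx), mul_comm]
  let τ : α × β → α × β := fun p =>
    if h : p ∈ C ∩ {p | p.1 ∈ K} then (hT.exists_mem p h).choose • p else p
  have hτ : ∀ p ∈ C ∩ {p | p.1 ∈ K}, τ p ∈ T ∧ ∃ g : G, τ p = g • p := fun p hp => by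
    have e : τ p = (hT.exists_mem p hp).choose • p := dif_pos hp
    exact ⟨e ▸ (hT.exists_mem p hp).choose_spec, _, e⟩
  rw [s₁, ← Finset.sum_fiberwise_of_maps_to (s := P) (t := T) (g := τ)
    fun p hp => (hτ p (hPC p hp)).1]
  refine Finset.sum_congr rfl fun t ht => ?_
  obtain ⟨htC, htK⟩ := hT.subset ht
  obtain ⟨h, hh⟩ := hR.exists_mem t.1 htK
  have hx₀ : h • t.1 ∈ K := hR.subset hh
  -- All edges of this orbit that start in `R` start at the same point `h • t.1`, since `R` has one
  -- point per orbit. They differ by elements of its stabilizer.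
  have hfib : (P.filter fun p => τ p = t) =
      ((orbit (stabilizer G (h • t.1)) (h • t.2)).image fun y => (h • t.1, y)) := by
    ext ⟨x, y⟩
    simp only [Finset.coe_filter, Set.mem_ofPred_eq, Set.mem_image, Prod.mk.injEq]
    constructor
    · rintro ⟨hp, he⟩
      obtain ⟨-, g, hg⟩ := hτ _ (hPC _ hp)
      rw [he] at hg
      have e₁ : t.1 = g • x := by rw [hg]; rfl
      have e₂ : t.2 = g • y := by rw [hg]; rfl
      have hx : x ∈ R := ((hP _).1 hp).1
      have e₃ : (h * g) • x = x := by
        refine hR.eq_of_smul x hx _ ?_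
        rw [mul_smul, ← e₁]
        exact hh
      have e₄ : h • t.1 = x := by rw [e₁, ← mul_smul, e₃]
      refine ⟨y, ?_, e₄, rfl⟩
      refine ⟨⟨(h * g)⁻¹, ?_⟩, ?_⟩
      · rw [mem_stabilizer_iff, inv_smul_eq_iff, e₄, e₃]
      · change (h * g)⁻¹ • h • t.2 = y
        rw [inv_smul_eq_iff, mul_smul, e₂]
    · rintro ⟨_, ⟨⟨s, hs⟩, rfl⟩, rfl, rfl⟩
      have hs' : s • h • t.1 = h • t.1 := hs
      have hmem : (h • t.1, s • h • t.2) = (s * h) • t := by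
        ext
        · simp only [mul_smul, Prod.smul_fst, hs']
        · simp only [mul_smul, Prod.smul_snd]
      change (h • t.1, s • h • t.2) ∈ P ∧ τ (h • t.1, s • h • t.2) = t
      have hc : (h • t.1, s • h • t.2) ∈ C := hmem ▸ hC _ htC _
      refine ⟨(hP _).2 ⟨hh, (hN _ hx₀ _).2 hc⟩, ?_⟩
      obtain ⟨h₁, g, hg⟩ := hτ _ ⟨hc, hx₀⟩
      rw [hg, hmem, ← mul_smul]
      refine hT.eq_of_smul t ht _ ?_
      rw [mul_smul, ← hmem, ← hg]
      exact h₁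
  have hcard : (P.filter fun p => τ p = t).card =
      (stabilizer G t.2).relIndex (stabilizer G t.1) := by
    rw [← Set.ncard_coe_finset, hfib, Set.ncard_image_of_injective _ (Prod.mk_right_injective _),
      ← relIndex_stabilizer, relIndex_stabilizer_smul]
  have hval : ∀ p ∈ P.filter fun p => τ p = t, u p.1 = u t.1 := fun p hp => by
    obtain ⟨hp, he⟩ := Finset.mem_filter.1 hp
    obtain ⟨-, g, hg⟩ := hτ _ (hPC _ hp)
    rw [← he, hg, Prod.smul_fst, hu _ (hPC _ hp).2]
  rw [Finset.sum_congr rfl hval, Finset.sum_const, hcard, nsmul_eq_mul, mul_comm]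

/-- The mass transport principle for an invariant correspondence. -/
theorem mass_transport {K : Set α} {K' : Set β} {C : Set (α × β)}
    (hC : ∀ p ∈ C, ∀ g : G, g • p ∈ C) (hCK : ∀ p ∈ C, p.1 ∈ K ↔ p.2 ∈ K')
    (hK : ∀ x ∈ K, ∀ g : G, g • x ∈ K)
    {R : Finset α} (hR : IsTransversal G K R) {R' : Finset β} (hR' : IsTransversal G K' R')
    {k l : ℕ} (hk : ∀ x ∈ K, {y | (x, y) ∈ C}.encard = k)
    (hl : ∀ y ∈ K', {x | (x, y) ∈ C}.encard = l) (u : α → ℚ) (v : β → ℚ)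
    (hu : ∀ x ∈ K, ∀ g : G, u (g • x) = u x) (hv : ∀ x ∈ K', ∀ g : G, v (g • x) = v x)
    (huv : ∀ p ∈ C, p.1 ∈ K → u p.1 * (stabilizer G p.2).relIndex (stabilizer G p.1) =
      v p.2 * (stabilizer G p.1).relIndex (stabilizer G p.2)) :
    (∑ x ∈ R, u x) * k = (∑ y ∈ R', v y) * l := by
  classical
  have hfin : ∀ x ∈ K, {y | (x, y) ∈ C}.Finite := fun x hx =>
    Set.finite_of_encard_eq_coe (hk x hx)
  -- There are finitely many orbits of edges: each edge can be moved to start in the finite set `R`,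
  -- and fibres are finite.
  obtain ⟨T, hT⟩ : ∃ T, IsTransversal G (C ∩ {p | p.1 ∈ K}) T := by
    refine exists_isTransversal (fun p hp g => ⟨hC p hp.1 g, hK _ hp.2 g⟩)
      (R₀ := ⋃ x ∈ R, (fun y => (x, y)) '' {y | (x, y) ∈ C}) ?_ ?_
    · exact R.finite_toSet.biUnion fun x hx => (hfin x (hR.subset hx)).image _
    · rintro ⟨x, y⟩ ⟨hp, hx⟩
      obtain ⟨g, hg⟩ := hR.exists_mem x hx
      refine ⟨g, Set.mem_biUnion hg ⟨g • y, hC _ hp g, rfl⟩⟩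
  -- The same representatives serve when edges are counted from the other end, because an edge has
  -- one end in `K` iff it has the other in `K'`.
  have hT' : IsTransversal G (Prod.swap ⁻¹' C ∩ {p : β × α | p.1 ∈ K'})
      (T.map (Equiv.prodComm α β).toEmbedding) := by
    refine ⟨?_, ?_, ?_⟩
    · intro p hp
      simp only [Finset.coe_map, Set.mem_image] at hp
      obtain ⟨q, hq, rfl⟩ := hp
      have := hT.subset hq
      exact ⟨this.1, (hCK _ this.1).1 this.2⟩
    · rintro ⟨y, x⟩ ⟨hp, hy⟩
      obtain ⟨g, hg⟩ := hT.exists_mem (x, y) ⟨hp, (hCK _ hp).2 hy⟩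
      exact ⟨g, Finset.mem_map.2 ⟨_, hg, rfl⟩⟩
    · rintro ⟨y, x⟩ hp g hg
      have h₁ : (x, y) ∈ T := by
        obtain ⟨⟨a, b⟩, hq, he⟩ := Finset.mem_map.1 hp
        cases he
        exact hq
      have h₂ : g • (x, y) ∈ T := by
        obtain ⟨⟨a, b⟩, hq, he⟩ := Finset.mem_map.1 hg
        cases he
        exact hq
      exact congrArg Prod.swap (hT.eq_of_smul _ h₁ g h₂)
  rw [sum_transversal_mul hC hR hT hk u hu,
    sum_transversal_mul (C := Prod.swap ⁻¹' C) (fun p hp g => hC _ hp g) hR' hT' hl v hv,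
    Finset.sum_map]
  exact Finset.sum_congr rfl fun t ht => huv t (hT.subset ht).1 (hT.subset ht).2

/-- In a locally finite connected structure on which `G` acts unimodularly, the ratios of the
measures of the stabilizers define an invariant weight. -/
theorem exists_weight {K : Set Z} {a₀ : Z} {Γ : Z → Z → Prop}
    (hK : ∀ x ∈ K, ∀ g : G, g • x ∈ K)
    (hΓG : ∀ x y, Γ x y → ∀ g : G, Γ (g • x) (g • y))
    (hΓ : ∀ x y, Γ x y → (stabilizer G x).Commensurable (stabilizer G y))
    (hconn : ∀ x ∈ K, Relation.ReflTransGen (fun x y => Γ x y ∨ y ∈ orbit G x) a₀ x)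
    (hU : ∀ (x : Z) (g : G), (stabilizer G x).Commensurable (stabilizer G (g • x)) →
      (stabilizer G x).relIndex (stabilizer G (g • x)) =
        (stabilizer G (g • x)).relIndex (stabilizer G x)) :
    ∃ u : Z → ℚ, (∀ x ∈ K, 0 < u x) ∧ (∀ x ∈ K, ∀ g : G, u (g • x) = u x) ∧
      ∀ x ∈ K, ∀ y ∈ K, Γ x y →
        u x * (stabilizer G y).relIndex (stabilizer G x) =
          u y * (stabilizer G x).relIndex (stabilizer G y) := by
  classical
  have key : ∀ x ∈ K, ∃ g : G, (stabilizer G a₀).Commensurable (stabilizer G (g • x)) := by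
    intro x hx
    have := hconn x hx
    clear hx
    induction this with
    | refl => exact ⟨1, by rw [one_smul]⟩
    | tail _ h ih =>
      obtain ⟨g, hg⟩ := ih
      rcases h with h | ⟨g', rfl⟩
      · exact ⟨g, hg.trans (hΓ _ _ (hΓG _ _ h g))⟩
      · exact ⟨g * g'⁻¹, by simpa [mul_smul] using hg⟩
  -- `γ x` moves `x` to a conjugate whose stabilizer can be compared with that of `a₀`. The weight
  -- of `x` is read off there, and `hinv` shows that the choice is immaterial.
  choose! γ hγ using key
  have hinv : ∀ x ∈ K, ∀ g : G, (stabilizer G a₀).Commensurable (stabilizer G (g • x)) →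
      indexRatio (stabilizer G a₀) (stabilizer G (γ x • x)) =
        indexRatio (stabilizer G a₀) (stabilizer G (g • x)) := by
    intro x hx g hg
    have hc : (stabilizer G (γ x • x)).Commensurable (stabilizer G (g • x)) :=
      (hγ x hx).symm.trans hg
    rw [← indexRatio_mul (hγ x hx) hc]
    have e : g • x = (g * (γ x)⁻¹) • γ x • x := by simp [mul_smul]
    -- Unimodularity enters here: two conjugates of `x` with commensurable stabilizers.
    have h1 : indexRatio (stabilizer G (γ x • x)) (stabilizer G (g • x)) = 1 := by
      rw [e] at hc ⊢
      rw [indexRatio, hU _ _ hc]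
      exact div_self (by exact_mod_cast hc.2)
    rw [h1, mul_one]
  refine ⟨fun x => indexRatio (stabilizer G a₀) (stabilizer G (γ x • x)),
    fun x hx => indexRatio_pos (hγ x hx), fun x hx g => ?_, fun x hx y hy h => ?_⟩
  · have h₁ := hγ (g • x) (hK x hx g)
    rw [← mul_smul] at h₁
    have := hinv x hx _ h₁
    simp only [this, mul_smul]
  · have hxy := hΓ _ _ (hΓG _ _ h (γ x))
    have := hinv y hy _ ((hγ x hx).trans hxy)
    simp only [this]
    rw [← indexRatio_mul (hγ x hx) hxy, mul_assoc]
    congr 1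
    rw [indexRatio, relIndex_stabilizer_smul, relIndex_stabilizer_smul, div_mul_cancel₀]
    rw [← relIndex_stabilizer_smul (γ x)]
    exact_mod_cast hxy.1

/-- The orbit of `a` is isolated in `K`. -/
def IsIsolatedOrbit (G : Type*) [Group G] {Z : Type*} [MulAction G Z] [TopologicalSpace Z]
    (K : Set Z) (a : Z) : Prop :=
  ∃ U, IsOpen U ∧ a ∈ U ∧ ∀ x ∈ K, x ∈ U → x ∈ orbit G a

/-- A minimal invariant closed set of a scattered compact space consists of finitely many
orbits, all of them in one connected component. -/
theorem exists_finite_component [TopologicalSpace Z] [CompactSpace Z] {W : Set Z}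
    (hW : IsClosed W) (hne : W.Nonempty) {Γ : Z → Z → Prop}
    (hΓ : ∀ x y, Γ x y → Γ y x) (hWΓ : ∀ x ∈ W, ∀ y, Γ x y → y ∈ W)
    (hG : ∀ K : Set Z, IsClosed K → ∀ x ∈ K, ∀ g : G, g • x ∈ K)
    (hscat : ∀ K : Set Z, IsClosed K → K.Nonempty → ∃ a ∈ K, IsIsolatedOrbit G K a)
    (hprop : ∀ K : Set Z, K ⊆ W → IsClosed K → (∀ x ∈ K, ∀ y, Γ x y → y ∈ K) →
      ∀ a ∈ K, ∀ b, Γ a b → IsIsolatedOrbit G K a → IsIsolatedOrbit G K b) :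
    ∃ K ⊆ W, IsClosed K ∧ (∀ x ∈ K, ∀ y, Γ x y → y ∈ K) ∧
      (∃ a₀ ∈ K, ∀ x ∈ K, Relation.ReflTransGen (fun x y => Γ x y ∨ y ∈ orbit G x) a₀ x) ∧
      ∃ R : Set Z, R.Finite ∧ ∀ x ∈ K, ∃ g : G, g • x ∈ R := by
  obtain ⟨K, hKW, hmin⟩ := zorn_superset_nonempty
    {K : Set Z | IsClosed K ∧ K.Nonempty ∧ ∀ x ∈ K, ∀ y, Γ x y → y ∈ K} (by
      intro c hc hchain hcne
      refine ⟨⋂₀ c, ⟨isClosed_sInter fun K hK => (hc hK).1, ?_, ?_⟩,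
        fun s hs => Set.sInter_subset_of_mem hs⟩
      · have := hcne.to_subtype
        rw [Set.sInter_eq_iInter]
        refine IsCompact.nonempty_iInter_of_directed_nonempty_isCompact_isClosed _ ?_
          (fun K => (hc K.2).2.1) (fun K => (hc K.2).1.isCompact) fun K => (hc K.2).1
        rintro ⟨s, hs⟩ ⟨t, ht⟩
        rcases hchain.total hs ht with h | h
        · exact ⟨⟨s, hs⟩, subset_rfl, h⟩
        · exact ⟨⟨t, ht⟩, h, subset_rfl⟩
      · intro x hx y hxy K hK
        exact (hc hK).2.2 x (hx K hK) y hxy) W ⟨hW, hne, hWΓ⟩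
  obtain ⟨hKc, hKne, hKΓ⟩ := hmin.prop
  obtain ⟨a₀, ha₀, hiso₀⟩ := hscat K hKc hKne
  have hreach : ∀ x, Relation.ReflTransGen (fun x y => Γ x y ∨ y ∈ orbit G x) a₀ x →
      x ∈ K ∧ IsIsolatedOrbit G K x := by
    intro x h
    induction h with
    | refl => exact ⟨ha₀, hiso₀⟩
    | tail _ h ih =>
      rcases h with h | h
      · exact ⟨hKΓ _ ih.1 _ h, hprop K hKW hKc hKΓ _ ih.1 _ h ih.2⟩
      · obtain ⟨U, hU, hxU, hU'⟩ := ih.2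
        obtain ⟨g, rfl⟩ := h
        refine ⟨hG K hKc _ ih.1 g, U, hU, ?_, ?_⟩
        · by_contra hn
          have := hG _ hU.isClosed_compl _ hn g⁻¹
          rw [inv_smul_smul] at this
          exact this hxU
        · intro z hz hzU
          rw [orbit_eq_iff.2 (mem_orbit _ g)]
          exact hU' z hz hzU
  -- Otherwise the unreached part of `K` is nonempty, closed and, by symmetry of `Γ`, stable under
  -- edges. By minimality it would be all of `K`, yet it omits `a₀`.
  have hall : ∀ x ∈ K, Relation.ReflTransGen (fun x y => Γ x y ∨ y ∈ orbit G x) a₀ x := by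
    by_contra! hcon
    obtain ⟨x, hx, hxn⟩ := hcon
    have : {x ∈ K | ¬ Relation.ReflTransGen (fun x y => Γ x y ∨ y ∈ orbit G x) a₀ x} ∈
        {K : Set Z | IsClosed K ∧ K.Nonempty ∧ ∀ x ∈ K, ∀ y, Γ x y → y ∈ K} := by
      refine ⟨?_, ⟨x, hx, hxn⟩, ?_⟩
      -- The reached part is open in `K`: each reached point has a neighbourhood meeting `K` only in
      -- its own orbit.
      · have e : {x ∈ K | ¬ Relation.ReflTransGen (fun x y => Γ x y ∨ y ∈ orbit G x) a₀ x} =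
            K ∩ ⋂₀ {F | IsClosed F ∧ ∀ x ∈ K, x ∉ F →
              Relation.ReflTransGen (fun x y => Γ x y ∨ y ∈ orbit G x) a₀ x} := by
          ext z
          constructor
          · rintro ⟨hz, hzn⟩
            refine ⟨hz, fun F hF => ?_⟩
            by_contra hzF
            exact hzn (hF.2 z hz hzF)
          · rintro ⟨hz, hzF⟩
            refine ⟨hz, fun hr => ?_⟩
            obtain ⟨U, hU, hzU, hU'⟩ := (hreach z hr).2
            refine hzF Uᶜ ⟨hU.isClosed_compl, fun y hy hyU => ?_⟩ hzU
            exact hr.tail (Or.inr (hU' y hy (not_not.1 hyU)))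
        rw [e]
        exact hKc.inter (isClosed_sInter fun F hF => hF.1)
      · rintro y ⟨hy, hyn⟩ z hyz
        exact ⟨hKΓ y hy z hyz, fun hr => hyn (hr.tail (Or.inl (hΓ _ _ hyz)))⟩
    exact (hmin.le_of_le this (fun z hz => hz.1) ha₀).2 .refl
  refine ⟨K, hKW, hKc, hKΓ, ⟨a₀, ha₀, hall⟩, ?_⟩
  choose! U hU hxU hU' using fun x (hx : x ∈ K) => (hreach x (hall x hx)).2
  obtain ⟨t, ht⟩ := hKc.isCompact.elim_nhds_subcover' (fun x _ => U x)
    fun x hx => (hU x hx).mem_nhds (hxU x hx)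
  refine ⟨Subtype.val '' (t : Set K), (Finset.finite_toSet _).image _, fun x hx => ?_⟩
  obtain ⟨y, hy, hxy⟩ := Set.mem_iUnion₂.1 (ht hx)
  obtain ⟨g, hg⟩ := hU' y y.2 x hx hxy
  exact ⟨g⁻¹, y, hy, by rw [← hg]; simp⟩

end Groups

/-! ### Definability over real parameters, and the action of automorphisms on sorts. -/

section Definability

variable {L : FirstOrder.Language.{u, v}} {M : Type w} [L.Structure M]

/-- A real representative of a class. -/
noncomputable def ImSort.rep (S : ImSort L M) (a : S.Elem) : Fin S.arity → M := Quotient.out a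

@[simp]
theorem ImSort.cls_rep (S : ImSort L M) (a : S.Elem) : S.cls (S.rep a) = a := Quotient.out_eq a

theorem ImSort.cls_eq_cls {S : ImSort L M} {v w : Fin S.arity → M} :
    S.cls v = S.cls w ↔ S.rel v w := Quotient.eq (r := S.rel)

theorem ImSort.cls_surjective (S : ImSort L M) : Function.Surjective S.cls :=
  fun a => ⟨S.rep a, S.cls_rep a⟩

/-- Substituting parameters for some of the variables. -/
theorem definable_section {B : Set M} {α β : Type*} {D : Set (α ⊕ β → M)} (hD : B.Definable L D)
    (w : β → M) (hw : ∀ j, w j ∈ B) : B.Definable L {v : α → M | Sum.elim v w ∈ D} := by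
  rw [Set.definable_iff_exists_formula_sum] at hD ⊢
  obtain ⟨φ, rfl⟩ := hD
  refine ⟨φ.relabel (Sum.elim Sum.inl (Sum.elim Sum.inr fun j => Sum.inl ⟨w j, hw j⟩)), ?_⟩
  ext v
  simp only [Set.mem_ofPred_eq, FirstOrder.Language.Formula.realize_relabel]
  refine iff_of_eq (congrArg φ.Realize ?_)
  ext (b | i | j) <;> rfl

theorem definable_cls_eq (B : Set M) (S : ImSort L M) {ι : Type*} (f g : Fin S.arity → ι) :
    B.Definable L {u : ι → M | S.cls (u ∘ f) = S.cls (u ∘ g)} := by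
  obtain ⟨φ, hφ⟩ := S.definable
  have h₀ : (∅ : Set M).Definable L {u | φ.Realize u} :=
    Set.empty_definable_iff.2 ⟨φ, rfl⟩
  have h := (h₀.mono (Set.empty_subset B)).preimage_comp (Sum.elim f g)
  convert! h using 1
  ext u
  rw [Set.mem_ofPred_eq, ImSort.cls_eq_cls, hφ]
  refine iff_of_eq (congrArg φ.Realize ?_)
  ext (i | j) <;> rfl

theorem definable_cls_eq_const {B : Set M} (S : ImSort L M) {ι : Type*} (f : Fin S.arity → ι)
    (a : S.Elem) (ha : ∀ i, S.rep a i ∈ B) :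
    B.Definable L {u : ι → M | S.cls (u ∘ f) = a} := by
  have h := definable_section (definable_cls_eq B S (Sum.inl ∘ f)
    (Sum.inr : Fin S.arity → ι ⊕ Fin S.arity)) (S.rep a) ha
  convert! h using 1
  ext u
  simp only [Set.mem_ofPred_eq, ← Function.comp_assoc, Sum.elim_comp_inl, Sum.elim_comp_inr,
    S.cls_rep]

theorem definable_eq (B : Set M) {ι : Type*} (i j : ι) :
    B.Definable L {u : ι → M | u i = u j} := by
  have h₀ : (∅ : Set M).Definable L {u : ι → M | u i = u j} :=
    Set.empty_definable_iff.2 ⟨(FirstOrder.Language.Term.var i).equal (.var j), by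
      ext u
      simp [FirstOrder.Language.Formula.realize_equal]⟩
  exact h₀.mono (Set.empty_subset B)

theorem definable_eq_const {B : Set M} {ι : Type*} (i : ι) {b : M} (hb : b ∈ B) :
    B.Definable L {u : ι → M | u i = b} := by
  exact definable_section (definable_eq (L := L) B (Sum.inl i) (Sum.inr () : ι ⊕ Unit))
    (fun _ => b) fun _ => hb

theorem definable_sInter {B : Set M} {ι : Type*} {F : Set (Set (ι → M))} (hfin : F.Finite)
    (hF : ∀ D ∈ F, B.Definable L D) : B.Definable L (⋂₀ F) := by
  induction F, hfin using Set.Finite.induction_on with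
  | empty => simp
  | insert _ _ ih =>
    rw [Set.sInter_insert]
    exact (hF _ (Set.mem_insert _ _)).inter (ih fun D hD => hF D (Set.mem_insert_of_mem _ hD))

/-- The saturation of a definable set of real pairs of tuples is definable. -/
theorem definable_saturation {B : Set M} (S S' : ImSort L M)
    {R : Set (Fin S.arity ⊕ Fin S'.arity → M)} (hR : B.Definable L R) :
    B.Definable L {u | ∃ v w, S.cls v = S.cls (u ∘ Sum.inl) ∧ S'.cls w = S'.cls (u ∘ Sum.inr) ∧
      Sum.elim v w ∈ R} := by
  have h := ((definable_cls_eq B S (Sum.inr ∘ Sum.inl) (Sum.inl ∘ Sum.inl :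
      _ → (Fin S.arity ⊕ Fin S'.arity) ⊕ (Fin S.arity ⊕ Fin S'.arity))).inter
    ((definable_cls_eq B S' (Sum.inr ∘ Sum.inr) (Sum.inl ∘ Sum.inr)).inter
      (hR.preimage_comp Sum.inr))).exists_of_finite
  convert! h using 1
  ext u
  constructor
  · rintro ⟨v, w, h₁, h₂, h₃⟩
    exact ⟨Sum.elim v w, h₁, h₂, h₃⟩
  · rintro ⟨z, h₁, h₂, h₃⟩
    refine ⟨z ∘ Sum.inl, z ∘ Sum.inr, h₁, h₂, ?_⟩
    rw [Sum.elim_comp_inl_inr]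
    exact h₃

variable (L) in
/-- The automorphisms of `M` over `B`. -/
def autGroup (B : Set M) : Subgroup (Equiv.Perm M) where
  carrier := {σ | (∃ τ : M ≃[L] M, ∀ x, τ x = σ x) ∧ ∀ b ∈ B, σ b = b}
  one_mem' := ⟨⟨FirstOrder.Language.Equiv.refl L M, fun _ => rfl⟩, fun _ _ => rfl⟩
  mul_mem' := by
    rintro σ₁ σ₂ ⟨⟨τ₁, h₁⟩, k₁⟩ ⟨⟨τ₂, h₂⟩, k₂⟩
    refine ⟨⟨τ₁.comp τ₂, fun x => ?_⟩, fun b hb => ?_⟩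
    · rw [FirstOrder.Language.Equiv.comp_apply, h₂, h₁]
      rfl
    · rw [Equiv.Perm.mul_apply, k₂ b hb, k₁ b hb]
  inv_mem' := by
    rintro σ ⟨⟨τ, h⟩, k⟩
    refine ⟨⟨τ.symm, fun x => ?_⟩, fun b hb => ?_⟩
    · rw [Equiv.Perm.eq_inv_iff_eq, ← h]
      exact τ.apply_symm_apply x
    · rw [Equiv.Perm.inv_eq_iff_eq, k b hb]

variable {B : Set M}

theorem autGroup_smul_of_mem (σ : autGroup L B) {b : M} (hb : b ∈ B) : σ • b = b :=
  σ.2.2 b hb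

theorem realize_smul (σ : autGroup L B) {ι : Type*} (φ : L.Formula ι) (v : ι → M) :
    φ.Realize (σ • v) ↔ φ.Realize v := by
  obtain ⟨τ, hτ⟩ := σ.2.1
  have h := FirstOrder.Language.StrongHomClass.realize_formula τ φ (v := v)
  rwa [show τ ∘ v = σ • v from funext fun i => hτ _] at h

theorem smul_mem_of_definable {ι : Type*} {D : Set (ι → M)} (hD : B.Definable L D)
    (σ : autGroup L B) {v : ι → M} : σ • v ∈ D ↔ v ∈ D := by
  obtain ⟨φ, rfl⟩ := Set.definable_iff_exists_formula_sum.1 hD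
  rw [Set.mem_ofPred_eq, Set.mem_ofPred_eq, ← realize_smul σ φ (Sum.elim _ v)]
  refine iff_of_eq (congrArg φ.Realize ?_)
  ext (b | i)
  · exact (autGroup_smul_of_mem σ b.2).symm
  · rfl

instance (S : ImSort L M) : MulAction (autGroup L B) S.Elem where
  smul σ := Quotient.map (fun v => σ • v) (by
    intro v w h
    change S.rel _ _
    replace h : S.rel v w := h
    obtain ⟨φ, hφ⟩ := S.definable
    rw [hφ] at h ⊢
    rw [← realize_smul σ] at h
    convert h using 1
    ext (i | i) <;> rfl)
  one_smul a := by
    obtain ⟨v, rfl⟩ := S.cls_surjective a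
    exact congrArg S.cls (one_smul _ v)
  mul_smul σ τ a := by
    obtain ⟨v, rfl⟩ := S.cls_surjective a
    exact congrArg S.cls (mul_smul σ τ v)

theorem ImSort.smul_cls (S : ImSort L M) (σ : autGroup L B) (v : Fin S.arity → M) :
    σ • S.cls v = S.cls (σ • v) := rfl

/-- A formula with parameters is preserved by the automorphisms which fix the parameters. -/
theorem RealDefinableOver.smul_mem {A : Set (Meq L M)} {ι : Type} {P : Set (ι → M)}
    (hP : RealDefinableOver A P) (σ : autGroup L B) (hσ : ∀ e ∈ A, σ • e.2 = e.2) {v : ι → M} :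
    σ • v ∈ P ↔ v ∈ P := by
  obtain ⟨m, e, he, φ, hφ⟩ := hP
  let w : ∀ i : Fin m, Fin (e i).1.arity → M := fun i => (e i).1.rep (e i).2
  have hw : ∀ i, (e i).1.cls (w i) = (e i).2 := fun i => ImSort.cls_rep _ _
  rw [hφ v w hw, hφ (σ • v) (fun i => σ • w i) fun i => by
    rw [← ImSort.smul_cls, hw, hσ _ (he i)], ← realize_smul σ φ (Sum.elim v _)]
  refine iff_of_eq (congrArg φ.Realize ?_)
  ext (i | i) <;> rfl

/-- Chosen real representatives of a set of imaginaries. -/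
def repSet (A : Set (Meq L M)) : Set M := ⋃ e ∈ A, Set.range (e.1.rep e.2)

theorem rep_mem_repSet {A : Set (Meq L M)} {e : Meq L M} (he : e ∈ A) (i : Fin e.1.arity) :
    e.1.rep e.2 i ∈ repSet A :=
  Set.mem_biUnion he ⟨i, rfl⟩

theorem repSet_mono {A A' : Set (Meq L M)} (h : A ⊆ A') : repSet A ⊆ repSet A' :=
  Set.biUnion_subset_biUnion_left h

theorem mk_repSet_lt {κ : Cardinal.{w}} (hκ : ℵ₀ < κ) {A : Set (Meq L M)} (hA : #A < κ) :
    #(repSet A) < κ := by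
  rw [repSet, Set.biUnion_eq_iUnion]
  refine mk_iUnion_le_sum_mk.trans_lt ((sum_le_sum _ (fun _ => ℵ₀) fun e => ?_).trans_lt ?_)
  · exact (Set.finite_range _).lt_aleph0.le
  · rw [sum_const', mul_comm]
    exact mul_lt_of_lt hκ.le hκ hA

theorem RealDefinableOver.definable {A : Set (Meq L M)} {ι : Type} {P : Set (ι → M)}
    (hP : RealDefinableOver A P) : (repSet A).Definable L P := by
  obtain ⟨m, e, he, φ, hφ⟩ := hP
  rw [Set.definable_iff_exists_formula_sum]
  refine ⟨φ.relabel (Sum.elim Sum.inr fun ij => Sum.inl ⟨_, rep_mem_repSet (he ij.1) ij.2⟩), ?_⟩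
  ext v
  rw [hφ v (fun i => (e i).1.rep (e i).2) fun i => ImSort.cls_rep _ _]
  simp only [Set.mem_ofPred_eq, FirstOrder.Language.Formula.realize_relabel]
  refine iff_of_eq (congrArg φ.Realize ?_)
  ext (i | i) <;> rfl

/-- Real representatives of finitely many imaginaries can be added to a small set. -/
theorem exists_params {κ : Cardinal.{w}} (hκ : ℵ₀ < κ) (hB : #B < κ) {A : Set (Meq L M)}
    (hA : #A < κ) :
    ∃ B' : Set M, B ⊆ B' ∧ #B' < κ ∧ ∀ e ∈ A, ∀ i, e.1.rep e.2 i ∈ B' :=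
  ⟨B ∪ repSet A, Set.subset_union_left, (mk_union_le _ _).trans_lt (add_lt_of_lt hκ.le hB
    (mk_repSet_lt hκ hA)), fun _ he i => Or.inr (rep_mem_repSet he i)⟩

variable (L M) in
/-- The sort of real `n`-tuples. -/
def tupleSort (n : ℕ) : ImSort L M where
  arity := n
  rel := ⊥
  definable := by
    have h : (∅ : Set M).Definable L
        {u : Fin n ⊕ Fin n → M | ∀ i, u (Sum.inl i) = u (Sum.inr i)} := by
      rw [Set.ofPred_forall]
      exact Set.definable_iInter_of_finite fun i => definable_eq _ _ _
    obtain ⟨φ, hφ⟩ := Set.empty_definable_iff.1 h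
    refine ⟨φ, fun v w => ?_⟩
    have : Sum.elim v w ∈ {u : Fin n ⊕ Fin n → M | ∀ i, u (Sum.inl i) = u (Sum.inr i)} ↔
      φ.Realize (Sum.elim v w) := by rw [hφ]; rfl
    rw [← this]
    exact funext_iff

/-- A real element, as an element of `M^eq`. -/
def realElem (x : M) : Meq L M := ⟨tupleSort L M 1, (tupleSort L M 1).cls fun _ => x⟩

variable (L) in
/-- A set of real elements, as a set of elements of `M^eq`. -/
def realSet (B : Set M) : Set (Meq L M) := realElem '' B

theorem smul_realSet (σ : autGroup L B) : ∀ e ∈ realSet L B, σ • e.2 = e.2 := by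
  rintro _ ⟨b, hb, rfl⟩
  exact congrArg (tupleSort L M 1).cls (funext fun _ => autGroup_smul_of_mem σ hb)

/-- The set of tuples whose pair with `b` satisfies a given formula over `B` is definable over
`B ∪ {b}`. -/
theorem realDefinableOver_adjoin {ι : Type} (S' : ImSort L M) (b : S'.Elem)
    {R : Set (ι ⊕ Fin S'.arity → M)} (hR : B.Definable L R)
    (hinv : ∀ v w w', S'.cls w = S'.cls w' → Sum.elim v w ∈ R → Sum.elim v w' ∈ R) :
    RealDefinableOver (adjoin (realSet L B) b) {v | Sum.elim v (S'.rep b) ∈ R} := by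
  classical
  obtain ⟨φ, rfl⟩ := Set.definable_iff_exists_formula_sum.1 hR
  -- Only finitely many elements of `B` occur in `φ`. They become real parameters listed after `b`,
  -- which takes index `0`.
  let F : Finset B := φ.freeVarFinset.preimage Sum.inl Sum.inl_injective.injOn
  let c : Fin F.card → B := fun i => (F.equivFin.symm i : F)
  let e : Fin (F.card + 1) → Meq L M :=
    Fin.cons ⟨S', b⟩ fun i => realElem (c i : M)
  let f : φ.freeVarFinset → ι ⊕ (Σ i, Fin (e i).1.arity) := fun x =>
    match x with
    | ⟨.inl x, h⟩ => .inr ⟨(F.equivFin ⟨x, Finset.mem_preimage.2 h⟩).succ, (0 : Fin 1)⟩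
    | ⟨.inr (.inl i), _⟩ => .inl i
    | ⟨.inr (.inr j), _⟩ => .inr ⟨0, j⟩
  refine ⟨F.card + 1, e, ?_, FirstOrder.Language.BoundedFormula.restrictFreeVar φ f, ?_⟩
  · intro i
    refine Fin.cases ?_ (fun i => ?_) i
    · exact Set.mem_insert _ _
    · exact Set.mem_insert_of_mem _ ⟨c i, (c i).2, rfl⟩
  · intro v w hw
    have h₀ : S'.cls (w 0) = S'.cls (S'.rep b) := (hw 0).trans (S'.cls_rep b).symm
    have h₁ : Sum.elim v (S'.rep b) ∈ {v : ι ⊕ Fin S'.arity → M | φ.Realize (Sum.elim (↑) v)} ↔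
        Sum.elim v (w 0) ∈ {v : ι ⊕ Fin S'.arity → M | φ.Realize (Sum.elim (↑) v)} :=
      ⟨hinv _ _ _ h₀.symm, hinv _ _ _ h₀⟩
    refine h₁.trans (Iff.symm ?_)
    refine FirstOrder.Language.BoundedFormula.realize_restrictFreeVar _ ?_
    rintro ⟨x | i | j, h⟩
    · have h₂ := hw (F.equivFin ⟨x, Finset.mem_preimage.2 h⟩).succ
      have h₃ : w (F.equivFin ⟨x, Finset.mem_preimage.2 h⟩).succ = fun _ : Fin 1 =>
          (c (F.equivFin ⟨x, Finset.mem_preimage.2 h⟩) : M) :=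
        ImSort.cls_eq_cls.1 h₂
      change w (F.equivFin ⟨x, Finset.mem_preimage.2 h⟩).succ (0 : Fin 1) = x
      rw [h₃]
      simp [c]
    · rfl
    · rfl

end Definability

/-! ### Types as orbits, multiplicities as indices of stabilizers. -/

section Saturation

variable {L : FirstOrder.Language.{u, v}} {M : Type w} [L.Structure M] {κ : Cardinal.{w}}
  {B : Set M}

theorem IsMonster.nonempty_sInter (hM : IsMonster L M κ) (hB : #B < κ) {ι : Type} [Finite ι]
    {F : Set (Set (ι → M))} (hF : ∀ D ∈ F, B.Definable L D)
    (hfip : ∀ F₀ ⊆ F, F₀.Finite → (⋂₀ F₀).Nonempty) : (⋂₀ F).Nonempty := by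
  obtain ⟨n, ⟨e⟩⟩ := Finite.exists_equiv_fin ι
  obtain ⟨v, hv⟩ := hM.saturated B hB n
    {φ | {v : ι → M | φ.Realize (v ∘ e.symm)} ∈ F} (by
      intro Δ hΔ hfin
      obtain ⟨v, hv⟩ := hfip ((fun φ : L[[B]].Formula (Fin n) =>
        {v : ι → M | φ.Realize (v ∘ e.symm)}) '' Δ) (by rintro _ ⟨φ, hφ, rfl⟩; exact hΔ hφ)
        (hfin.image _)
      exact ⟨v ∘ e.symm, fun φ hφ => hv _ ⟨φ, hφ, rfl⟩⟩)
  refine ⟨v ∘ e, fun D hD => ?_⟩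
  obtain ⟨φ, rfl⟩ := hF D hD
  have h := hv (φ.relabel e) (by
    rw [Set.mem_ofPred_eq]
    convert! hD using 1
    ext u
    rw [Set.mem_ofPred_eq, FirstOrder.Language.Formula.realize_relabel, Function.comp_assoc,
      Equiv.symm_comp_self, Function.comp_id]
    rfl)
  rw [FirstOrder.Language.Formula.realize_relabel] at h
  exact h

/-- Strong homogeneity extends the map fixing `B` and sending `v` to `v'`. Entries of `v` may repeat
or lie in `B`; `g` picks one name for each element, and equality, being definable, makes the choice
harmless. -/
theorem IsMonster.exists_smul_eq (hM : IsMonster L M κ) (hB : #B < κ) {ι : Type} [Finite ι]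
    {v v' : ι → M} (h : ∀ D : Set (ι → M), B.Definable L D → v ∈ D → v' ∈ D) :
    ∃ σ : autGroup L B, σ • v = v' := by
  classical
  have hA : #(B ∪ Set.range v : Set M) < κ :=
    (mk_union_le _ _).trans_lt (add_lt_of_lt hM.uncountable.le hB
      ((Set.finite_range v).lt_aleph0.trans hM.uncountable))
  let g : (B ∪ Set.range v : Set M) → B ⊕ ι := fun x =>
    if hx : (x : M) ∈ B then .inl ⟨x, hx⟩ else .inr (x.2.resolve_left hx).choose
  have hg : ∀ x, Sum.elim (↑) v (g x) = (x : M) := by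
    intro x
    by_cases hx : (x : M) ∈ B
    · simp [g, hx]
    · simpa [g, hx] using (x.2.resolve_left hx).choose_spec
  have hdef : ∀ φ : L.Formula (B ∪ Set.range v : Set M),
      B.Definable L {u : ι → M | φ.Realize (Sum.elim (↑) u ∘ g)} := by
    intro φ
    rw [Set.definable_iff_exists_formula_sum]
    exact ⟨φ.relabel g, by
      ext u
      simp only [Set.mem_ofPred_eq, FirstOrder.Language.Formula.realize_relabel]⟩
  have hv : (Sum.elim (↑) v ∘ g : _ → M) = (↑) := funext hg
  obtain ⟨σ, hσ⟩ := hM.homogeneous _ hA (Sum.elim (↑) v' ∘ g) (by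
    intro φ
    constructor
    · intro hφ
      exact h _ (hdef φ) (by rwa [Set.mem_ofPred_eq, hv])
    · intro hφ
      by_contra hn
      exact h _ (hdef φ).compl (by rwa [Set.mem_compl_iff, Set.mem_ofPred_eq, hv]) hφ)
  refine ⟨⟨σ.toEquiv, ⟨σ, fun _ => rfl⟩, fun b hb => ?_⟩, funext fun i => ?_⟩
  · refine (hσ ⟨b, Or.inl hb⟩).trans ?_
    simp [g, hb]
  · refine (hσ ⟨v i, Or.inr ⟨i, rfl⟩⟩).trans ?_
    by_cases hi : v i ∈ B
    · simpa [g, hi] using (h _ (definable_eq_const i hi) rfl).symm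
    · have hx : v ((⟨v i, Or.inr ⟨i, rfl⟩⟩ : (B ∪ Set.range v : Set M)).2.resolve_left hi).choose
        = v i := ((⟨v i, Or.inr ⟨i, rfl⟩⟩ :
          (B ∪ Set.range v : Set M)).2.resolve_left hi).choose_spec
      simpa [g, hi] using h _ (definable_eq B _ _) hx

/-- If the type of a pair of representatives of `a` and `b` over `B` is finitely satisfiable by
representatives of `a'` and `b`, then `a` and `a'` are conjugate over `B ∪ {b}`. -/
theorem IsMonster.exists_smul_eq_of_pair (hM : IsMonster L M κ) (hB : #B < κ) {S S' : ImSort L M}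
    {a a' : S.Elem} {b : S'.Elem}
    (H : ∀ R : Set (Fin S.arity ⊕ Fin S'.arity → M), B.Definable L R →
      Sum.elim (S.rep a) (S'.rep b) ∈ R →
        ∃ v w, S.cls v = a' ∧ S'.cls w = b ∧ Sum.elim v w ∈ R) :
    ∃ σ : autGroup L B, σ • b = b ∧ σ • a = a' := by
  obtain ⟨B', hBB', hB', hrep⟩ := exists_params hM.uncountable hB
    (((Set.finite_singleton (⟨S', b⟩ : Meq L M)).insert ⟨S, a'⟩).lt_aleph0.trans hM.uncountable)
  have ha' : ∀ i, S.rep a' i ∈ B' := hrep ⟨S, a'⟩ (Or.inl rfl)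
  have hb' : ∀ i, S'.rep b i ∈ B' := hrep ⟨S', b⟩ (Or.inr rfl)
  let F₁ : Set (Set (Fin S.arity ⊕ Fin S'.arity → M)) :=
    {R | B.Definable L R ∧ Sum.elim (S.rep a) (S'.rep b) ∈ R}
  let E : Set (Fin S.arity ⊕ Fin S'.arity → M) := {u | S.cls (u ∘ Sum.inl) = a'}
  let E' : Set (Fin S.arity ⊕ Fin S'.arity → M) := {u | S'.cls (u ∘ Sum.inr) = b}
  -- `z` is a pair of representatives of `a'` and `b` with the same type over `B` as the chosen
  -- representatives of `a` and `b`. The extra parameters in `B'` serve only to define `E` and `E'`.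
  obtain ⟨z, hz⟩ := hM.nonempty_sInter hB' (F := F₁ ∪ {E, E'}) (by
    rintro D (⟨hD, -⟩ | rfl | rfl)
    · exact hD.mono hBB'
    · exact definable_cls_eq_const S _ _ ha'
    · exact definable_cls_eq_const S' _ _ hb') (by
    intro F₀ hF₀ hfin
    obtain ⟨v, w, hv, hw, hvw⟩ := H (⋂₀ (F₀ ∩ F₁))
      (definable_sInter (hfin.inter_of_left _) fun D hD => hD.2.1) fun D hD => hD.2.2
    refine ⟨Sum.elim v w, fun D hD => ?_⟩
    rcases hF₀ hD with h | rfl | rfl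
    · exact hvw D ⟨hD, h⟩
    · exact hv
    · exact hw)
  obtain ⟨σ, hσ⟩ := hM.exists_smul_eq hB (v := Sum.elim (S.rep a) (S'.rep b)) (v' := z)
    fun D hD hm => hz D (Or.inl ⟨hD, hm⟩)
  refine ⟨σ, ?_, ?_⟩
  · have : S'.cls (z ∘ Sum.inr) = b := hz E' (Or.inr (Set.mem_insert_of_mem _ rfl))
    rw [← hσ] at this
    rw [← S'.cls_rep b, S'.smul_cls]
    rw [S'.cls_rep]
    exact this
  · have : S.cls (z ∘ Sum.inl) = a' := hz E (Or.inr (Set.mem_insert _ _))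
    rw [← hσ] at this
    rw [← S.cls_rep a, S.smul_cls]
    exact this

theorem IsMonster.exists_smul_eq_of_definable (hM : IsMonster L M κ) (hB : #B < κ)
    {S : ImSort L M} {a a' : S.Elem}
    (h : ∀ D : Set S.Elem, B.Definable L (S.cls ⁻¹' D) → a ∈ D → a' ∈ D) :
    ∃ σ : autGroup L B, σ • a = a' := by
  -- The statement for pairs is used with the empty tuple in the place of `b`.
  let w₀ : Fin (tupleSort L M 0).arity → M := Fin.elim0
  have hw₀ : ∀ w, w = w₀ := fun w => funext fun i => Fin.elim0 i
  obtain ⟨σ, -, hσ⟩ := hM.exists_smul_eq_of_pair hB (S := S) (S' := tupleSort L M 0) (a := a)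
    (a' := a') (b := (tupleSort L M 0).cls w₀) (by
    intro R hR hm
    obtain ⟨v, w, hv, -, hvw⟩ := h {x | ∃ v w, S.cls v = x ∧
        (tupleSort L M 0).cls w = (tupleSort L M 0).cls w₀ ∧ Sum.elim v w ∈ R}
      (definable_section (definable_saturation S (tupleSort L M 0) hR) w₀ fun i => Fin.elim0 i)
      ⟨_, _, S.cls_rep a, by rw [hw₀ (ImSort.rep _ _)], hm⟩
    exact ⟨v, w, hv, by rw [hw₀ w], hvw⟩)
  exact ⟨σ, hσ⟩

/-- The set of those `x` which satisfy together with `b` a given formula over `B` is definable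
over `B ∪ {b}`. -/
theorem definableOver_adjoin (S S' : ImSort L M) (b : S'.Elem)
    {R : Set (Fin S.arity ⊕ Fin S'.arity → M)} (hR : B.Definable L R) :
    DefinableOver (adjoin (realSet L B) b) S.cls
      {x | ∃ v w, S.cls v = x ∧ S'.cls w = b ∧ Sum.elim v w ∈ R} := by
  have h := realDefinableOver_adjoin S' b (definable_saturation S S' hR) (by
    rintro v w w' hw ⟨v₁, w₁, h₁, h₂, h₃⟩
    exact ⟨v₁, w₁, h₁, h₂.trans hw, h₃⟩)
  rw [DefinableOver]
  convert! h using 1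
  ext u
  simp only [Set.mem_preimage, Set.mem_ofPred_eq, Sum.elim_comp_inl, Sum.elim_comp_inr, S'.cls_rep]

theorem smul_adjoin_realSet {S' : ImSort L M} {b : S'.Elem} (σ : autGroup L B) (hσ : σ • b = b) :
    ∀ e ∈ adjoin (realSet L B) b, σ • e.2 = e.2 := by
  rintro e (rfl | he)
  · exact hσ
  · exact smul_realSet σ e he

theorem DefinableOver.smul_mem {A : Set (Meq L M)} {S : ImSort L M} {X : Set S.Elem}
    (hX : DefinableOver A S.cls X) (σ : autGroup L B) (hσ : ∀ e ∈ A, σ • e.2 = e.2) {x : S.Elem} :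
    σ • x ∈ X ↔ x ∈ X := by
  obtain ⟨v, rfl⟩ := S.cls_surjective x
  exact RealDefinableOver.smul_mem hX σ hσ

theorem IsMonster.typeEq_adjoin_iff (hM : IsMonster L M κ) (hB : #B < κ) {S S' : ImSort L M}
    {a a' : S.Elem} {b : S'.Elem} :
    TypeEq (adjoin (realSet L B) b) a' a ↔ ∃ σ : autGroup L B, σ • b = b ∧ σ • a = a' := by
  constructor
  · intro h
    refine hM.exists_smul_eq_of_pair hB fun R hR hm => ?_
    exact (h _ (definableOver_adjoin S S' b hR)).2 ⟨_, _, S.cls_rep a, S'.cls_rep b, hm⟩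
  · rintro ⟨σ, hb, rfl⟩ X hX
    exact hX.smul_mem σ (smul_adjoin_realSet σ hb)

open MulAction in
-- The realizations of the type of `a` over `B` and `b` form the orbit of `a` under the stabilizer
-- of `b`.
theorem IsMonster.mult_adjoin (hM : IsMonster L M κ) (hB : #B < κ) {S S' : ImSort L M}
    (a : S.Elem) (b : S'.Elem) :
    mult (adjoin (realSet L B) b) a =
      (stabilizer (autGroup L B) a).relIndex (stabilizer (autGroup L B) b) := by
  rw [relIndex_stabilizer, mult]
  congr 1
  ext x
  rw [Set.mem_ofPred_eq, hM.typeEq_adjoin_iff hB]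
  exact ⟨fun ⟨σ, h₁, h₂⟩ => ⟨⟨σ, h₁⟩, h₂⟩, fun ⟨σ, h⟩ => ⟨σ, σ.2, h⟩⟩

open MulAction in
-- If no formula over `B` and `b` isolated `a` within its finite orbit, saturation would realize its
-- type outside that orbit, against homogeneity.
theorem IsMonster.algebraicOver_adjoin (hM : IsMonster L M κ) (hB : #B < κ) {S S' : ImSort L M}
    {a : S.Elem} {b : S'.Elem} (h : (orbit (stabilizer (autGroup L B) b) a).Finite) :
    AlgebraicOver (adjoin (realSet L B) b) a := by
  obtain ⟨B', hBB', hB', hrep⟩ := exists_params hM.uncountable hB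
    (((h.image fun x : S.Elem => (⟨S, x⟩ : Meq L M)).insert ⟨S', b⟩).lt_aleph0.trans
      hM.uncountable)
  have hb' : ∀ i, S'.rep b i ∈ B' := hrep ⟨S', b⟩ (Or.inl rfl)
  have ho' : ∀ o ∈ orbit (stabilizer (autGroup L B) b) a, ∀ i, S.rep o i ∈ B' :=
    fun o ho => hrep ⟨S, o⟩ (Or.inr ⟨o, ho, rfl⟩)
  let F₁ : Set (Set (Fin S.arity ⊕ Fin S'.arity → M)) :=
    {R | B.Definable L R ∧ Sum.elim (S.rep a) (S'.rep b) ∈ R}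
  let E : S.Elem → Set (Fin S.arity ⊕ Fin S'.arity → M) := fun o =>
    {u | S.cls (u ∘ Sum.inl) = o}ᶜ
  let E' : Set (Fin S.arity ⊕ Fin S'.arity → M) := {u | S'.cls (u ∘ Sum.inr) = b}
  by_contra hn
  obtain ⟨z, hz⟩ := hM.nonempty_sInter hB'
    (F := F₁ ∪ insert E' (E '' orbit (stabilizer (autGroup L B) b) a)) (by
    rintro D (⟨hD, -⟩ | rfl | ⟨o, ho, rfl⟩)
    · exact hD.mono hBB'
    · exact definable_cls_eq_const S' _ _ hb'
    · exact (definable_cls_eq_const S _ _ (ho' o ho)).compl) (by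
    intro F₀ hF₀ hfin
    by_contra hne
    refine hn ⟨_, definableOver_adjoin S S' b (R := ⋂₀ (F₀ ∩ F₁))
      (definable_sInter (hfin.inter_of_left _) fun D hD => hD.2.1), h.subset ?_,
      ⟨_, _, S.cls_rep a, S'.cls_rep b, fun D hD => hD.2.2⟩⟩
    rintro _ ⟨v, w, rfl, hw, hvw⟩
    by_contra hv
    refine hne ⟨Sum.elim v w, fun D hD => ?_⟩
    rcases hF₀ hD with h | rfl | ⟨o, ho, rfl⟩
    · exact hvw D ⟨hD, h⟩
    · exact hw
    · intro he
      exact hv ((show S.cls v = o from he) ▸ ho))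
  obtain ⟨σ, hσ⟩ := hM.exists_smul_eq hB (v := Sum.elim (S.rep a) (S'.rep b)) (v' := z)
    fun D hD hm => hz D (Or.inl ⟨hD, hm⟩)
  have hb : σ • b = b := by
    have : S'.cls (z ∘ Sum.inr) = b := hz E' (Or.inr (Set.mem_insert _ _))
    rw [← hσ] at this
    conv_lhs => rw [← S'.cls_rep b, S'.smul_cls]
    exact this
  have ha : σ • a = S.cls (z ∘ Sum.inl) := by
    rw [← hσ]
    conv_lhs => rw [← S.cls_rep a, S.smul_cls]
    rfl
  have hmem := mem_orbit a (⟨σ, hb⟩ : stabilizer (autGroup L B) b)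
  exact hz (E (σ • a)) (Or.inr (Set.mem_insert_of_mem _ ⟨_, hmem, rfl⟩)) ha.symm

open MulAction in
-- The group-theoretic form of unimodularity: commensurability of the stabilizers of `a` and `σ • a`
-- is interalgebraicity, and the two indices are the multiplicities.
theorem Unimodular.relIndex_eq (hU : Unimodular L M κ) (hM : IsMonster L M κ) (hB : #B < κ)
    {S : ImSort L M} (a : S.Elem) (σ : autGroup L B)
    (h : (stabilizer (autGroup L B) a).Commensurable (stabilizer (autGroup L B) (σ • a))) :
    (stabilizer (autGroup L B) a).relIndex (stabilizer (autGroup L B) (σ • a)) =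
      (stabilizer (autGroup L B) (σ • a)).relIndex (stabilizer (autGroup L B) a) := by
  have h₁ := h.1
  have h₂ := h.2
  rw [relIndex_stabilizer] at h₁ h₂
  rw [← hM.mult_adjoin hB, ← hM.mult_adjoin hB]
  refine hU _ (mk_image_le.trans_lt hB) S a (σ • a) ?_
    (hM.algebraicOver_adjoin hB (Set.finite_of_ncard_ne_zero h₁))
    (hM.algebraicOver_adjoin hB (Set.finite_of_ncard_ne_zero h₂))
  intro X hX
  exact (hX.smul_mem σ (smul_realSet σ)).symm

end Saturation

/-! ### Type spaces as compact scattered topologies on the sorts. -/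

section TypeSpace

theorem exists_finite_of_subset_image {α β : Type*} {f : α → β} {s : Set α} {t : Set β}
    (h : t ⊆ f '' s) (ht : t.Finite) : ∃ u ⊆ s, u.Finite ∧ t = f '' u := by
  classical
  lift t to Finset β using ht
  obtain ⟨u, hu, rfl⟩ := Finset.subset_set_image_iff.1 h
  exact ⟨u, hu, u.finite_toSet, by simp⟩

variable {L : FirstOrder.Language.{u, v}} {M : Type w} [L.Structure M] {κ : Cardinal.{w}}
  {B : Set M}

/-- Definability of a set of elements of a sort over a set of real parameters. -/
def ImSort.IsDef (B : Set M) (S : ImSort L M) (D : Set S.Elem) : Prop :=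
  B.Definable L (S.cls ⁻¹' D)

/-- Type-definability over a set of real parameters. -/
def IsTypeDef (L : FirstOrder.Language.{u, v}) [L.Structure M] (B : Set M) {ι : Type} {Z : Type w}
    (q : (ι → M) → Z) (X : Set Z) : Prop :=
  ∃ F : Set (Set Z), (∀ D ∈ F, B.Definable L (q ⁻¹' D)) ∧ X = ⋂₀ F

theorem IsTypeDef.mono {B' : Set M} (h : B ⊆ B') {ι : Type} {Z : Type w} {q : (ι → M) → Z}
    {X : Set Z} (hX : IsTypeDef L B q X) : IsTypeDef L B' q X := by
  obtain ⟨F, hF, rfl⟩ := hX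
  exact ⟨F, fun D hD => (hF D hD).mono h, rfl⟩

theorem TypeDefinableOver.isTypeDef {A : Set (Meq L M)} {ι : Type} {Z : Type w} {q : (ι → M) → Z}
    {X : Set Z} (hX : TypeDefinableOver A q X) : IsTypeDef L (repSet A) q X := by
  obtain ⟨F, hF, rfl⟩ := hX
  exact ⟨F, fun D hD => RealDefinableOver.definable (hF D hD), rfl⟩

theorem ImSort.IsDef.sInter {S : ImSort L M} {F : Set (Set S.Elem)} (hfin : F.Finite)
    (hF : ∀ D ∈ F, S.IsDef B D) : S.IsDef B (⋂₀ F) := by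
  have h := definable_sInter (B := B) (hfin.image (S.cls ⁻¹' ·)) (by
    rintro _ ⟨D, hD, rfl⟩
    exact hF D hD)
  rwa [Set.sInter_image, ← Set.preimage_iInter₂, ← Set.sInter_eq_biInter] at h

theorem ImSort.IsDef.smul_mem {S : ImSort L M} {D : Set S.Elem} (hD : S.IsDef B D)
    (σ : autGroup L B) {x : S.Elem} : σ • x ∈ D ↔ x ∈ D := by
  obtain ⟨v, rfl⟩ := S.cls_surjective x
  exact smul_mem_of_definable hD σ

theorem IsTypeDef.smul_mem {S : ImSort L M} {X : Set S.Elem} (hX : IsTypeDef L B S.cls X)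
    (σ : autGroup L B) {x : S.Elem} (hx : x ∈ X) : σ • x ∈ X := by
  obtain ⟨F, hF, rfl⟩ := hX
  exact fun D hD => (ImSort.IsDef.smul_mem (hF D hD) σ).2 (hx D hD)

theorem IsTypeDef.smul_mem_pair {S S' : ImSort L M} {C : Set (S.Elem × S'.Elem)}
    (hC : IsTypeDef L B (S.clsPair S') C) (σ : autGroup L B) {p : S.Elem × S'.Elem} (hp : p ∈ C) :
    σ • p ∈ C := by
  obtain ⟨F, hF, rfl⟩ := hC
  obtain ⟨x, y⟩ := p
  obtain ⟨v, rfl⟩ := S.cls_surjective x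
  obtain ⟨w, rfl⟩ := S'.cls_surjective y
  exact fun D hD => (smul_mem_of_definable (hF D hD) σ (v := Sum.elim v w)).2 (hp D hD)

/-- The topology on a sort generated by the sets definable over `B`: its Kolmogorov quotient is the
space of types over `B`. -/
abbrev ImSort.typeTopology (B : Set M) (S : ImSort L M) : TopologicalSpace S.Elem :=
  .generateFrom {D | S.IsDef B D}

theorem ImSort.isTopologicalBasis (B : Set M) (S : ImSort L M) :
    @TopologicalSpace.IsTopologicalBasis _ (S.typeTopology B) {D | S.IsDef B D} := by
  let := S.typeTopology B
  refine ⟨?_, ?_, rfl⟩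
  · intro D₁ h₁ D₂ h₂ x hx
    exact ⟨D₁ ∩ D₂, Set.Definable.inter h₁ h₂, hx, subset_rfl⟩
  · exact Set.eq_univ_of_univ_subset (Set.subset_sUnion_of_mem (Set.definable_univ (A := B) (L := L)
      (α := Fin S.arity)))

theorem ImSort.isClosed_iff {S : ImSort L M} {X : Set S.Elem} :
    @IsClosed _ (S.typeTopology B) X ↔ IsTypeDef L B S.cls X := by
  let := S.typeTopology B
  constructor
  · intro h
    refine ⟨{D | S.IsDef B D ∧ X ⊆ D}, fun D hD => hD.1, ?_⟩
    refine subset_antisymm (fun x hx D hD => hD.2 hx) fun x hx => ?_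
    by_contra hn
    obtain ⟨D, hD, hxD, hDX⟩ := (S.isTopologicalBasis B).exists_subset_of_mem_open
      (show x ∈ Xᶜ from hn) h.isOpen_compl
    exact hx Dᶜ ⟨Set.Definable.compl hD, Set.subset_compl_comm.1 hDX⟩ hxD
  · rintro ⟨F, hF, rfl⟩
    refine isClosed_sInter fun D hD => ?_
    rw [← isOpen_compl_iff]
    exact (S.isTopologicalBasis B).isOpen (Set.Definable.compl (hF D hD))

theorem IsMonster.compactSpace (hM : IsMonster L M κ) (hB : #B < κ) (S : ImSort L M) :
    @CompactSpace _ (S.typeTopology B) := by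
  let := S.typeTopology B
  refine ⟨isCompact_generateFrom rfl fun P hP hcov => ?_⟩
  by_contra! hcon
  obtain ⟨v, hv⟩ := hM.nonempty_sInter hB (F := (fun D => (S.cls ⁻¹' D)ᶜ) '' P) (by
    rintro _ ⟨D, hD, rfl⟩
    exact (hP hD).compl) (by
    intro F₀ hF₀ hfin
    obtain ⟨Q, hQP, hQ, rfl⟩ := exists_finite_of_subset_image hF₀ hfin
    obtain ⟨x, -, hx⟩ := Set.not_subset.1 (hcon Q hQP hQ)
    refine ⟨S.rep x, ?_⟩
    rintro _ ⟨D, hD, rfl⟩ h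
    rw [Set.mem_preimage, S.cls_rep] at h
    exact hx ⟨D, hD, h⟩)
  obtain ⟨D, hD, hvD⟩ := hcov (Set.mem_univ (S.cls v))
  exact hv _ ⟨D, hD, rfl⟩ hvD

/-- In an `ω`-stable theory the spaces of types are scattered. -/
theorem IsOmegaStable.exists_isIsolatedOrbit {T : L.Theory} (hω : IsOmegaStable.{u, v, w} T)
    [Nonempty M] [T.Model M] (hM : IsMonster L M κ) (hB : #B < κ) (S : ImSort L M) {K : Set S.Elem}
    (hne : K.Nonempty) :
    ∃ a ∈ K, ∃ D, S.IsDef B D ∧ a ∈ D ∧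
      ∀ x ∈ K, x ∈ D → x ∈ MulAction.orbit (autGroup L B) a := by
  by_contra! hcon
  -- Without isolated orbits, every definable set meeting `K` splits into two disjoint ones that
  -- meet `K`. This grows a binary tree with continuum many branches.
  let N := {D : Set S.Elem // S.IsDef B D ∧ (K ∩ D).Nonempty}
  have hsplit : ∀ D : N, ∃ E : Bool → N, (∀ i, (E i : Set S.Elem) ⊆ D) ∧
      Disjoint (E true : Set S.Elem) (E false) := by
    rintro ⟨D, hD, a, haK, haD⟩
    obtain ⟨x, hxK, hxD, hx⟩ := hcon a haK D hD haD
    have : ¬ ∀ E : Set S.Elem, B.Definable L (S.cls ⁻¹' E) → a ∈ E → x ∈ E := fun h =>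
      hx (hM.exists_smul_eq_of_definable hB h)
    push Not at this
    obtain ⟨E, hE, haE, hxE⟩ := this
    refine ⟨fun i => cond i ⟨D ∩ E, Set.Definable.inter hD hE, a, haK, haD, haE⟩
      ⟨D \ E, Set.Definable.sdiff hD hE, x, hxK, hxD, hxE⟩, ?_, ?_⟩
    · rintro (_ | _)
      · exact Set.sdiff_subset
      · exact Set.inter_subset_left
    · exact Set.disjoint_left.2 fun y hy hy' => hy'.2 hy.2
  choose split hsub hdisj using hsplit
  let root : N := ⟨Set.univ, Set.definable_univ, by simpa using hne⟩
  let tree : List Bool → N := fun s => s.rec root fun b _ D => split D b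
  let path : (ℕ → Bool) → ℕ → List Bool := fun f n => n.rec [] fun n s => f n :: s
  have hpath : ∀ f g : ℕ → Bool, ∀ n, (∀ i < n, f i = g i) → path f n = path g n := by
    intro f g n
    induction n with
    | zero => intro _; rfl
    | succ n ih =>
      intro h
      change f n :: path f n = g n :: path g n
      rw [h n n.lt_succ_self, ih fun i hi => h i (hi.trans n.lt_succ_self)]
  have hanti : ∀ f m n, m ≤ n → (tree (path f n)).1 ⊆ (tree (path f m)).1 := by
    intro f m n hmn
    induction n, hmn using Nat.le_induction with
    | base => exact subset_rfl
    | succ n _ ih => exact (hsub (tree (path f n)) (f n)).trans ih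
  have hbranch : ∀ f : ℕ → Bool, ∃ v : Fin S.arity → M, ∀ n, S.cls v ∈ (tree (path f n)).1 := by
    intro f
    obtain ⟨v, hv⟩ := hM.nonempty_sInter hB
      (F := Set.range fun n => S.cls ⁻¹' (tree (path f n)).1) (by
      rintro _ ⟨n, rfl⟩
      exact (tree (path f n)).2.1) (by
      intro F₀ hF₀ hfin
      obtain ⟨Q, -, hQ, rfl⟩ := exists_finite_of_subset_image (Set.image_univ.symm ▸ hF₀) hfin
      obtain ⟨m, hm⟩ := hQ.bddAbove
      obtain ⟨x, -, hx⟩ := (tree (path f m)).2.2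
      refine ⟨S.rep x, ?_⟩
      rintro _ ⟨n, hn, rfl⟩
      refine hanti f _ _ (hm hn) ?_
      rwa [S.cls_rep])
    exact ⟨v, fun n => hv _ ⟨n, rfl⟩⟩
  choose br hbr using hbranch
  -- The tree has countably many nodes, each using finitely many parameters. Its branches thus give
  -- continuum many types over the countable set `A₀`.
  choose A hAB hA using fun s => Set.definable_iff_finitely_definable.1 (tree s).2.1
  let A₀ : Set M := ⋃ s, (A s : Set M)
  have hA₀ : A₀.Countable := Set.countable_iUnion fun s => (A s).countable_toSet
  have hcount : Countable ((L[[A₀]].completeTheory M).CompleteType (Fin S.arity)) :=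
    hω (FirstOrder.Language.Theory.ModelType.of T M) A₀ hA₀ S.arity
  have hinj : Function.Injective fun f => (L[[A₀]].completeTheory M).typeOf (br f) := by
    intro f g hfg
    by_contra hne
    have hex : ∃ n, f n ≠ g n := Function.ne_iff.1 hne
    classical
    have hn := Nat.find_spec hex
    have hlt : ∀ i < Nat.find hex, f i = g i := fun i hi => not_not.1 (Nat.find_min hex hi)
    set n := Nat.find hex
    obtain ⟨φ, hφ⟩ := (hA (path f (n + 1))).mono (Set.subset_iUnion (fun s => (A s : Set M)) _)
    have h₁ : φ.Realize (br f) := by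
      have : br f ∈ S.cls ⁻¹' (tree (path f (n + 1))).1 := hbr f (n + 1)
      rwa [hφ] at this
    rw [← FirstOrder.Language.Theory.CompleteType.formula_mem_typeOf
      (T := L[[A₀]].completeTheory M)] at h₁
    have h₂ : φ.Realize (br g) := by
      rw [← FirstOrder.Language.Theory.CompleteType.formula_mem_typeOf
        (T := L[[A₀]].completeTheory M)]
      have hfg' : (L[[A₀]].completeTheory M).typeOf (br f) =
        (L[[A₀]].completeTheory M).typeOf (br g) := hfg
      rwa [hfg'] at h₁
    have h₃ : br g ∈ S.cls ⁻¹' (tree (path f (n + 1))).1 := by rwa [hφ]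
    have h₄ : S.cls (br g) ∈ (split (tree (path f n)) (g n)).1 := by
      rw [hpath f g n hlt]
      exact hbr g (n + 1)
    have h₅ : S.cls (br g) ∈ (split (tree (path f n)) (f n)).1 := h₃
    have h₆ : ∀ p q : Bool, p ≠ q → S.cls (br g) ∈ (split (tree (path f n)) p).1 →
        S.cls (br g) ∈ (split (tree (path f n)) q).1 → False := by
      have h := Set.disjoint_left.1 (hdisj (tree (path f n)))
      rintro (_ | _) (_ | _) hpq hp hq
      · exact hpq rfl
      · exact h hq hp
      · exact h hp hq
      · exact hpq rfl
    exact h₆ _ _ hn h₅ h₄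
  have : Countable (ℕ → Bool) := hinj.countable
  obtain ⟨e, he⟩ := exists_injective_nat (ℕ → Bool)
  refine Function.cantor_injective
    (fun s : Set ℕ => e fun n => @decide (n ∈ s) (Classical.dec _)) fun s t h => ?_
  ext n
  simpa using congrFun (he h) n

end TypeSpace

/-! ### Isolation of types passes along a correspondence. -/

section Correspondence

variable {L : FirstOrder.Language.{u, v}} {M : Type w} [L.Structure M] {κ : Cardinal.{w}}
  {B : Set M}

open MulAction in
/-- Isolation propagates along a correspondence with finite fibres of constant size. -/
theorem IsMonster.isolated_of_correspondence (hM : IsMonster L M κ) (hB : #B < κ)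
    {S S' : ImSort L M} {K : Set S.Elem} {K' : Set S'.Elem} {C : Set (S.Elem × S'.Elem)}
    (hK' : IsTypeDef L B S'.cls K') (hC : IsTypeDef L B (S.clsPair S') C)
    (hCK : ∀ x y, (x, y) ∈ C → y ∈ K' → x ∈ K) {l : ℕ}
    (hl : ∀ y ∈ K', {x | (x, y) ∈ C}.encard = l) {a : S.Elem} {b : S'.Elem} (hab : (a, b) ∈ C)
    (hfin : {y | (a, y) ∈ C}.Finite) {D : Set S.Elem} (hD : S.IsDef B D) (haD : a ∈ D)
    (hiso : ∀ x ∈ K, x ∈ D → x ∈ orbit (autGroup L B) a) :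
    ∃ D', S'.IsDef B D' ∧ b ∈ D' ∧ ∀ y ∈ K', y ∈ D' → y ∈ orbit (autGroup L B) b := by
  classical
  -- Near `b`, every point of `K'` has a neighbour in `D`. If not, compactness yields a conjugate of
  -- `b` with `l` distinct neighbours outside `D`. These are all its neighbours, but the
  -- corresponding conjugate of `a` is another one, inside `D`.
  obtain ⟨E, hE, hbE, hEK⟩ : ∃ E, S'.IsDef B E ∧ b ∈ E ∧
      ∀ y ∈ K', y ∈ E → ∃ x ∈ D, (x, y) ∈ C := by
    by_contra! hcon
    let y : ((Fin S'.arity ⊕ Fin l × Fin S.arity) → M) → S'.Elem := fun z =>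
      S'.cls (z ∘ Sum.inl)
    let x : ((Fin S'.arity ⊕ Fin l × Fin S.arity) → M) → Fin l → S.Elem := fun z i =>
      S.cls (z ∘ fun j => Sum.inr (i, j))
    let good : Set ((Fin S'.arity ⊕ Fin l × Fin S.arity) → M) :=
      {z | y z ∈ K' ∧ Function.Injective (x z) ∧ ∀ i, (x z i, y z) ∈ C ∧ x z i ∉ D}
    have hgood : ∀ E : Set S'.Elem, S'.IsDef B E → b ∈ E → ∃ z ∈ good, y z ∈ E := by
      intro E hE hbE
      obtain ⟨c, hcK, hcE, hc⟩ := hcon E hE hbE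
      have hcard := hl c hcK
      have hfin := Set.finite_of_encard_eq_coe hcard
      rw [hfin.encard_eq_coe_toFinset_card, Nat.cast_inj] at hcard
      let e := hfin.toFinset.equivFinOfCardEq hcard
      have he : ∀ i, ((e.symm i : S.Elem), c) ∈ C := fun i =>
        hfin.mem_toFinset.1 (e.symm i).2
      let z : (Fin S'.arity ⊕ Fin l × Fin S.arity) → M :=
        Sum.elim (S'.rep c) fun p => S.rep (e.symm p.1 : S.Elem) p.2
      have hy : y z = c := S'.cls_rep c
      have hx : ∀ i, x z i = e.symm i := fun i => S.cls_rep (e.symm i : S.Elem)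
      refine ⟨z, ⟨hy ▸ hcK, ?_, fun i => ?_⟩, hy ▸ hcE⟩
      · intro i j hij
        rw [hx, hx] at hij
        exact e.symm.injective (Subtype.ext hij)
      · rw [hx, hy]
        exact ⟨he i, fun h => hc _ h (he i)⟩
    -- `good` need not be type-definable, so `z` is only required to lie in every definable set
    -- containing it. Each property of `good` used below is an intersection of definable conditions,
    -- hence holds of `z`.
    obtain ⟨z, hz⟩ := hM.nonempty_sInter hB
      (F := (y ⁻¹' ·) '' {E | S'.IsDef B E ∧ b ∈ E} ∪ {P | B.Definable L P ∧ good ⊆ P}) (by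
      rintro _ (⟨E, ⟨hE, -⟩, rfl⟩ | ⟨hP, -⟩)
      · exact Set.Definable.preimage_comp Sum.inl hE
      · exact hP) (by
      intro F₀ hF₀ hfin
      obtain ⟨Q, hQ, hQfin, hQF⟩ := exists_finite_of_subset_image
        (f := (y ⁻¹' ·)) (s := {E | S'.IsDef B E ∧ b ∈ E})
        (t := F₀ ∩ (y ⁻¹' ·) '' {E | S'.IsDef B E ∧ b ∈ E}) Set.inter_subset_right
        (hfin.inter_of_left _)
      obtain ⟨z, hz, hzQ⟩ := hgood (⋂₀ Q) (.sInter hQfin fun E hE => (hQ hE).1)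
        fun E hE => (hQ hE).2
      refine ⟨z, fun P hP => ?_⟩
      rcases hF₀ hP with h | h
      · obtain ⟨E, hE, rfl⟩ := hQF.subset ⟨hP, h⟩
        exact hzQ E hE
      · exact h.2 hz)
    have hz' : ∀ P, B.Definable L P → good ⊆ P → z ∈ P := fun P hP h => hz P (Or.inr ⟨hP, h⟩)
    have hzinj : Function.Injective (x z) := by
      intro i j hij
      by_contra hne
      refine hz' {z | x z i = x z j}ᶜ (definable_cls_eq B S _ _).compl ?_ hij
      exact fun u hu h => hne (hu.2.1 h)
    have hzC : ∀ i, (x z i, y z) ∈ C := by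
      intro i
      obtain ⟨F, hF, rfl⟩ := hC
      intro P hP
      refine hz' {z | (x z i, y z) ∈ P} ?_ fun u hu => (hu.2.2 i).1 P hP
      exact (hF P hP).preimage_comp (Sum.elim (fun j => Sum.inr (i, j)) Sum.inl)
    have hzD : ∀ i, x z i ∉ D := by
      intro i
      exact hz' {z | x z i ∈ D}ᶜ
        (Set.Definable.preimage_comp (fun j => Sum.inr (i, j)) hD).compl fun u hu => (hu.2.2 i).2
    have hzK : y z ∈ K' := by
      obtain ⟨F, hF, rfl⟩ := hK'
      intro P hP
      exact hz' {z | y z ∈ P} ((hF P hP).preimage_comp Sum.inl) fun u hu => hu.1 P hP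
    obtain ⟨σ, hσ⟩ := hM.exists_smul_eq_of_definable hB (a := b) (a' := y z)
      fun E hE hbE => hz _ (Or.inl ⟨E, ⟨hE, hbE⟩, rfl⟩)
    have hσC : (σ • a, y z) ∈ C := hσ ▸ hC.smul_mem_pair σ hab
    have hrange : Set.range (x z) = {x | (x, y z) ∈ C} := by
      refine Set.Finite.eq_of_subset_of_encard_le (Set.finite_range _) ?_ ?_
      · rintro _ ⟨i, rfl⟩
        exact hzC i
      · rw [hl _ hzK, ← Set.image_univ, hzinj.encard_image]
        simp
    obtain ⟨i, hi⟩ : σ • a ∈ Set.range (x z) := hrange ▸ hσC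
    exact hzD i (hi ▸ (hD.smul_mem σ).2 haD)
  have hsep : ∀ y : S'.Elem, y ∉ orbit (autGroup L B) b →
      ∃ P : Set S'.Elem, S'.IsDef B P ∧ b ∈ P ∧ y ∉ P := by
    intro y hy
    by_contra! hcon
    exact hy (hM.exists_smul_eq_of_definable hB hcon)
  choose! P hP hbP hyP using hsep
  -- A point of `K'` in `E` has a neighbour in `D`, which is conjugate to `a`, so the point is
  -- conjugate to a neighbour of `a`. It remains to cut away the types of the finitely many
  -- neighbours of `a` that are not conjugate to `b`.
  refine ⟨⋂₀ insert E (P '' ({y | (a, y) ∈ C} \ orbit (autGroup L B) b)),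
    .sInter (((hfin.subset Set.sdiff_subset).image _).insert _) ?_, ?_, ?_⟩
  · rintro _ (rfl | ⟨y, hy, rfl⟩)
    · exact hE
    · exact hP y hy.2
  · rintro _ (rfl | ⟨y, hy, rfl⟩)
    · exact hbE
    · exact hbP y hy.2
  · intro y hyK hy
    obtain ⟨x, hxD, hxy⟩ := hEK y hyK (hy E (Set.mem_insert _ _))
    obtain ⟨σ, hσ⟩ := hiso x (hCK x y hxy hyK) hxD
    replace hσ : σ • a = x := hσ
    have hay : (a, σ⁻¹ • y) ∈ C := by
      have := hC.smul_mem_pair σ⁻¹ hxy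
      rwa [Prod.smul_mk, ← hσ, inv_smul_smul] at this
    by_contra hn
    have hn' : σ⁻¹ • y ∉ orbit (autGroup L B) b := by
      rintro ⟨τ, hτ⟩
      refine hn ⟨σ * τ, ?_⟩
      replace hτ : τ • b = σ⁻¹ • y := hτ
      change (σ * τ) • b = y
      rw [mul_smul, hτ, smul_inv_smul]
    refine hyP _ hn' ?_
    rw [(hP _ hn').smul_mem]
    exact hy _ (Set.mem_insert_of_mem _ ⟨_, ⟨hay, hn'⟩, rfl⟩)

end Correspondence

/-! ### Stabilizers and orbits in a disjoint union of two actions. -/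

section SumActions

open MulAction

variable {G α β : Type*} [Group G] [MulAction G α] [MulAction G β]

theorem stabilizer_inl (a : α) : stabilizer G (Sum.inl a : α ⊕ β) = stabilizer G a := by
  ext g
  rw [mem_stabilizer_iff, mem_stabilizer_iff, Sum.smul_inl, Sum.inl_injective.eq_iff]

theorem stabilizer_inr (b : β) : stabilizer G (Sum.inr b : α ⊕ β) = stabilizer G b := by
  ext g
  rw [mem_stabilizer_iff, mem_stabilizer_iff, Sum.smul_inr, Sum.inr_injective.eq_iff]

theorem inl_mem_orbit_inl {a x : α} : (Sum.inl x : α ⊕ β) ∈ orbit G (Sum.inl a) ↔ x ∈ orbit G a :=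
  ⟨fun ⟨g, hg⟩ => ⟨g, Sum.inl_injective hg⟩, fun ⟨g, hg⟩ => ⟨g, congrArg Sum.inl hg⟩⟩

theorem inr_mem_orbit_inr {b y : β} : (Sum.inr y : α ⊕ β) ∈ orbit G (Sum.inr b) ↔ y ∈ orbit G b :=
  ⟨fun ⟨g, hg⟩ => ⟨g, Sum.inr_injective hg⟩, fun ⟨g, hg⟩ => ⟨g, congrArg Sum.inr hg⟩⟩

theorem relIndex_stabilizer_ne_zero {x : α} {y : β} {s : Set β} (hs : s.Finite)
    (h : ∀ g : G, g • x = x → g • y ∈ s) :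
    (stabilizer G y).relIndex (stabilizer G x) ≠ 0 := by
  rw [relIndex_stabilizer]
  have hfin : (orbit (stabilizer G x) y).Finite := hs.subset (by
    rintro _ ⟨g, rfl⟩
    exact h g g.2)
  exact ((Set.ncard_pos hfin).2 (nonempty_orbit y)).ne'

/-- The endpoints of an edge of a locally finite invariant correspondence have commensurable
stabilizers. -/
theorem commensurable_stabilizer {C : Set (α × β)} (hC : ∀ p ∈ C, ∀ g : G, g • p ∈ C) {x : α}
    {y : β} (hxy : (x, y) ∈ C) (hx : {y | (x, y) ∈ C}.Finite) (hy : {x | (x, y) ∈ C}.Finite) :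
    (stabilizer G x).Commensurable (stabilizer G y) := by
  refine ⟨relIndex_stabilizer_ne_zero hy fun g hg => ?_,
    relIndex_stabilizer_ne_zero hx fun g hg => ?_⟩
  · have := hC _ hxy g
    rwa [Prod.smul_mk, hg] at this
  · have := hC _ hxy g
    rwa [Prod.smul_mk, hg] at this

end SumActions

/-! ### The graph of two uniform correspondences, and the three conclusions. -/

section Main

open MulAction

variable {L : FirstOrder.Language.{u, v}} {M : Type w} [L.Structure M] {κ : Cardinal.{w}}
  {B : Set M}

theorem IsTypeDef.inter {ι : Type} {Z : Type w} {q : (ι → M) → Z} {X Y : Set Z}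
    (hX : IsTypeDef L B q X) (hY : IsTypeDef L B q Y) : IsTypeDef L B q (X ∩ Y) := by
  obtain ⟨F, hF, rfl⟩ := hX
  obtain ⟨F', hF', rfl⟩ := hY
  exact ⟨F ∪ F', fun D hD => hD.elim (hF D) (hF' D), (Set.sInter_union _ _).symm⟩

theorem isTypeDef_of_definable {ι : Type} {Z : Type w} {q : (ι → M) → Z} {X : Set Z}
    (hX : B.Definable L (q ⁻¹' X)) : IsTypeDef L B q X :=
  ⟨{X}, fun _ hD => hD ▸ hX, (Set.sInter_singleton X).symm⟩

theorem IsTypeDef.preimage {ι ι' : Type} {Z Z' : Type w} {q : (ι → M) → Z} {q' : (ι' → M) → Z'}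
    {X : Set Z} (hX : IsTypeDef L B q X) (f : Z' → Z) (g : ι → ι')
    (hfg : ∀ v, f (q' v) = q (v ∘ g)) : IsTypeDef L B q' (f ⁻¹' X) := by
  obtain ⟨F, hF, rfl⟩ := hX
  refine ⟨(f ⁻¹' ·) '' F, ?_, by rw [Set.sInter_image, Set.preimage_sInter]⟩
  rintro _ ⟨D, hD, rfl⟩
  convert! (hF D hD).preimage_comp g using 1
  ext v
  rw [Set.mem_preimage, Set.mem_preimage, hfg]
  rfl

theorem IsTypeDef.swap {S S' : ImSort L M} {C : Set (S.Elem × S'.Elem)}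
    (hC : IsTypeDef L B (S.clsPair S') C) : IsTypeDef L B (S'.clsPair S) (Prod.swap ⁻¹' C) :=
  hC.preimage Prod.swap Sum.swap fun _ => rfl

theorem IsTypeDef.fst {S S' : ImSort L M} {X : Set S.Elem} (hX : IsTypeDef L B S.cls X) :
    IsTypeDef L B (S.clsPair S') (Prod.fst ⁻¹' X) :=
  hX.preimage Prod.fst Sum.inl fun _ => rfl

theorem IsTypeDef.snd {S S' : ImSort L M} {Y : Set S'.Elem} (hY : IsTypeDef L B S'.cls Y) :
    IsTypeDef L B (S.clsPair S') (Prod.snd ⁻¹' Y) :=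
  hY.preimage Prod.snd Sum.inr fun _ => rfl

/-- Uniform correspondences over a set of real parameters. -/
structure IsUniform (L : FirstOrder.Language.{u, v}) [L.Structure M] (B : Set M)
    {S S' : ImSort L M} (X : Set S.Elem) (Y : Set S'.Elem) (C : Set (S.Elem × S'.Elem))
    (k l : ℕ) : Prop where
  nonempty : C.Nonempty
  isTypeDef : IsTypeDef L B (S.clsPair S') C
  subset : C ⊆ X ×ˢ Y
  fibre_left : ∀ x ∈ X, {y | (x, y) ∈ C}.encard = k
  fibre_right : ∀ y ∈ Y, {x | (x, y) ∈ C}.encard = l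

theorem IsUniformCorrespondence.isUniform {A : Set (Meq L M)} {S S' : ImSort L M}
    {X : Set S.Elem} {Y : Set S'.Elem} {C : Set (S.Elem × S'.Elem)} {k l : ℕ}
    (h : IsUniformCorrespondence A X Y C k l) (hAB : repSet A ⊆ B) : IsUniform L B X Y C k l :=
  ⟨h.nonempty, h.typeDefinable.isTypeDef.mono hAB, h.subset, h.fibre_left, h.fibre_right⟩

namespace IsUniform

variable {S S' : ImSort L M} {X : Set S.Elem} {Y : Set S'.Elem} {C : Set (S.Elem × S'.Elem)}
  {k l : ℕ}

theorem swap (h : IsUniform L B X Y C k l) : IsUniform L B Y X (Prod.swap ⁻¹' C) l k where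
  nonempty := by
    obtain ⟨⟨x, y⟩, hp⟩ := h.nonempty
    exact ⟨(y, x), hp⟩
  isTypeDef := h.isTypeDef.swap
  subset := fun _ hp => ⟨(h.subset hp).2, (h.subset hp).1⟩
  fibre_left := h.fibre_right
  fibre_right := h.fibre_left

theorem finite_left (h : IsUniform L B X Y C k l) {x : S.Elem} {y : S'.Elem} (hxy : (x, y) ∈ C) :
    {y | (x, y) ∈ C}.Finite :=
  Set.finite_of_encard_eq_coe (h.fibre_left x (h.subset hxy).1)

theorem ne_zero_left (h : IsUniform L B X Y C k l) : k ≠ 0 := by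
  rintro rfl
  obtain ⟨⟨x, y⟩, hp⟩ := h.nonempty
  have := h.fibre_left x (h.subset hp).1
  rw [Nat.cast_zero, Set.encard_eq_zero] at this
  exact this.subset hp

theorem ne_zero_right (h : IsUniform L B X Y C k l) : l ≠ 0 :=
  h.swap.ne_zero_left

theorem commensurable (h : IsUniform L B X Y C k l) {x : S.Elem} {y : S'.Elem}
    (hxy : (x, y) ∈ C) :
    (stabilizer (autGroup L B) x).Commensurable (stabilizer (autGroup L B) y) :=
  commensurable_stabilizer (fun _ hp σ => h.isTypeDef.smul_mem_pair σ hp) hxy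
    (h.finite_left hxy) (h.swap.finite_left (x := y) (y := x) hxy)

end IsUniform

/-- Isolation of an orbit by a definable set. -/
def IsDefIsolated (L : FirstOrder.Language.{u, v}) [L.Structure M] (B : Set M) {S : ImSort L M}
    (K : Set S.Elem) (a : S.Elem) : Prop :=
  ∃ D, S.IsDef B D ∧ a ∈ D ∧ ∀ x ∈ K, x ∈ D → x ∈ orbit (autGroup L B) a

theorem isIsolatedOrbit_inl_iff {S S' : ImSort L M} {K : Set (S.Elem ⊕ S'.Elem)} {a : S.Elem} :
    letI := S.typeTopology B
    letI := S'.typeTopology B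
    IsIsolatedOrbit (autGroup L B) K (Sum.inl a) ↔ IsDefIsolated L B (Sum.inl ⁻¹' K) a := by
  let := S.typeTopology B
  let := S'.typeTopology B
  constructor
  · rintro ⟨U, hU, haU, h⟩
    obtain ⟨D, hD, haD, hDU⟩ := (S.isTopologicalBasis B).exists_subset_of_mem_open
      (show a ∈ Sum.inl ⁻¹' U from haU) (hU.preimage continuous_inl)
    exact ⟨D, hD, haD, fun x hx hxD => inl_mem_orbit_inl.1 (h _ hx (hDU hxD))⟩
  · rintro ⟨D, hD, haD, h⟩
    refine ⟨Sum.inl '' D, isOpenMap_inl _ ((S.isTopologicalBasis B).isOpen hD), ⟨a, haD, rfl⟩, ?_⟩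
    rintro _ hx ⟨x, hxD, rfl⟩
    exact inl_mem_orbit_inl.2 (h x hx hxD)

theorem isIsolatedOrbit_inr_iff {S S' : ImSort L M} {K : Set (S.Elem ⊕ S'.Elem)} {b : S'.Elem} :
    letI := S.typeTopology B
    letI := S'.typeTopology B
    IsIsolatedOrbit (autGroup L B) K (Sum.inr b) ↔ IsDefIsolated L B (Sum.inr ⁻¹' K) b := by
  let := S.typeTopology B
  let := S'.typeTopology B
  constructor
  · rintro ⟨U, hU, hbU, h⟩
    obtain ⟨D, hD, hbD, hDU⟩ := (S'.isTopologicalBasis B).exists_subset_of_mem_open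
      (show b ∈ Sum.inr ⁻¹' U from hbU) (hU.preimage continuous_inr)
    exact ⟨D, hD, hbD, fun x hx hxD => inr_mem_orbit_inr.1 (h _ hx (hDU hxD))⟩
  · rintro ⟨D, hD, hbD, h⟩
    refine ⟨Sum.inr '' D, isOpenMap_inr _ ((S'.isTopologicalBasis B).isOpen hD), ⟨b, hbD, rfl⟩, ?_⟩
    rintro _ hx ⟨x, hxD, rfl⟩
    exact inr_mem_orbit_inr.2 (h x hx hxD)

theorem IsUniform.isDefIsolated (hM : IsMonster L M κ) (hB : #B < κ) {S S' : ImSort L M}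
    {X : Set S.Elem} {Y : Set S'.Elem} {C : Set (S.Elem × S'.Elem)} {k l : ℕ}
    (h : IsUniform L B X Y C k l) {K : Set S.Elem} {K' : Set S'.Elem} (hK'Y : K' ⊆ Y)
    (hK' : IsTypeDef L B S'.cls K') (hCK : ∀ x y, (x, y) ∈ C → y ∈ K' → x ∈ K) {a : S.Elem}
    {b : S'.Elem} (hab : (a, b) ∈ C) (ha : IsDefIsolated L B K a) : IsDefIsolated L B K' b := by
  obtain ⟨D, hD, haD, hiso⟩ := ha
  exact hM.isolated_of_correspondence hB hK' h.isTypeDef hCK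
    (fun y hy => h.fibre_right y (hK'Y hy)) hab (h.finite_left hab) hD haD hiso

/-- The union of two correspondences, as a graph on the disjoint union of the two sides. -/
inductive Edge {α β : Type*} (C₁ C₂ : Set (α × β)) : α ⊕ β → α ⊕ β → Prop
  | right {x y} : (x, y) ∈ C₁ ∪ C₂ → Edge C₁ C₂ (.inl x) (.inr y)
  | left {x y} : (x, y) ∈ C₁ ∪ C₂ → Edge C₁ C₂ (.inr y) (.inl x)

/-- There is a nonempty closed set of types which consists of finitely many orbits and is
a component of the graph given by two correspondences. -/
theorem exists_finite_component_of_isUniform {T : L.Theory} (hω : IsOmegaStable.{u, v, w} T)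
    [Nonempty M] [T.Model M] (hM : IsMonster L M κ) (hB : #B < κ) {S S' : ImSort L M}
    {X : Set S.Elem} {Y : Set S'.Elem} (hX : IsTypeDef L B S.cls X) (hY : IsTypeDef L B S'.cls Y)
    {C₁ C₂ : Set (S.Elem × S'.Elem)} {k₁ l₁ k₂ l₂ : ℕ} (h₁ : IsUniform L B X Y C₁ k₁ l₁)
    (h₂ : IsUniform L B X Y C₂ k₂ l₂) :
    ∃ K : Set (S.Elem ⊕ S'.Elem), Sum.inl ⁻¹' K ⊆ X ∧ Sum.inr ⁻¹' K ⊆ Y ∧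
      (∀ x ∈ K, ∀ σ : autGroup L B, σ • x ∈ K) ∧
      (∀ x ∈ K, ∀ y, Edge C₁ C₂ x y → y ∈ K) ∧
      (∃ a₀ ∈ K, ∀ x ∈ K, Relation.ReflTransGen
        (fun x y => Edge C₁ C₂ x y ∨ y ∈ orbit (autGroup L B) x) a₀ x) ∧
      ∃ R : Set (S.Elem ⊕ S'.Elem), R.Finite ∧ ∀ x ∈ K, ∃ σ : autGroup L B, σ • x ∈ R := by
  let := S.typeTopology B
  let := S'.typeTopology B
  have := hM.compactSpace hB S
  have := hM.compactSpace hB S'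
  have hGinv : ∀ K : Set (S.Elem ⊕ S'.Elem), IsClosed K → ∀ x ∈ K, ∀ σ : autGroup L B,
      σ • x ∈ K := by
    rintro K hK (x | y) hx σ
    · exact (ImSort.isClosed_iff.1 (hK.preimage continuous_inl)).smul_mem σ
        (show x ∈ Sum.inl ⁻¹' K from hx)
    · exact (ImSort.isClosed_iff.1 (hK.preimage continuous_inr)).smul_mem σ
        (show y ∈ Sum.inr ⁻¹' K from hx)
  have hsubset : C₁ ∪ C₂ ⊆ X ×ˢ Y := Set.union_subset h₁.subset h₂.subset
  have hW : IsClosed (Sum.elim X Y : Set (S.Elem ⊕ S'.Elem)) :=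
    isClosed_sum_iff.2 ⟨ImSort.isClosed_iff.2 hX, ImSort.isClosed_iff.2 hY⟩
  obtain ⟨K, hKW, hKc, hKΓ, hconn, hfin⟩ := exists_finite_component (G := autGroup L B)
    (W := (Sum.elim X Y : Set (S.Elem ⊕ S'.Elem))) (Γ := Edge C₁ C₂) hW
    (by
      obtain ⟨⟨x, y⟩, hp⟩ := h₁.nonempty
      exact ⟨Sum.inl x, (h₁.subset hp).1⟩)
    (by
      rintro _ _ (h | h)
      · exact .left h
      · exact .right h)
    (by
      rintro _ - _ (h | h)
      · exact (hsubset h).2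
      · exact (hsubset h).1)
    hGinv
    (by
      rintro K hK ⟨x | y, hx⟩
      · obtain ⟨a, ha, h⟩ := hω.exists_isIsolatedOrbit hM hB S
          (K := Sum.inl ⁻¹' K) ⟨x, hx⟩
        exact ⟨Sum.inl a, ha, isIsolatedOrbit_inl_iff.2 h⟩
      · obtain ⟨a, ha, h⟩ := hω.exists_isIsolatedOrbit hM hB S'
          (K := Sum.inr ⁻¹' K) ⟨y, hx⟩
        exact ⟨Sum.inr a, ha, isIsolatedOrbit_inr_iff.2 h⟩)
    (by
      intro K hKW hK hKΓ a ha b hab hiso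
      have hKl := ImSort.isClosed_iff.1 (hK.preimage continuous_inl)
      have hKr := ImSort.isClosed_iff.1 (hK.preimage continuous_inr)
      rcases hab with @⟨x, y, h⟩ | @⟨x, y, h⟩
      · rw [isIsolatedOrbit_inl_iff] at hiso
        rw [isIsolatedOrbit_inr_iff]
        rcases h with h | h
        · exact h₁.isDefIsolated hM hB (fun y hy => hKW hy) hKr
            (fun x y hxy hy => hKΓ _ hy _ (.left (Or.inl hxy))) h hiso
        · exact h₂.isDefIsolated hM hB (fun y hy => hKW hy) hKr
            (fun x y hxy hy => hKΓ _ hy _ (.left (Or.inr hxy))) h hiso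
      · rw [isIsolatedOrbit_inr_iff] at hiso
        rw [isIsolatedOrbit_inl_iff]
        rcases h with h | h
        · exact h₁.swap.isDefIsolated hM hB (fun y hy => hKW hy) hKl
            (fun y x hxy hx => hKΓ _ hx _ (.right (Or.inl hxy))) h hiso
        · exact h₂.swap.isDefIsolated hM hB (fun y hy => hKW hy) hKl
            (fun y x hxy hx => hKΓ _ hx _ (.right (Or.inr hxy))) h hiso)
  exact ⟨K, fun x hx => hKW hx, fun y hy => hKW hy, hGinv K hKc, hKΓ, hconn, hfin⟩

/-- Both ratios equal the quotient of the total weights of the two sides of one finite component.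
The weight is built from `C₁ ∪ C₂`, so the same one balances either correspondence. -/
theorem Unimodular.div_eq_div {T : L.Theory} (hω : IsOmegaStable.{u, v, w} T)
    [Nonempty M] [T.Model M] (hM : IsMonster L M κ) (hU : Unimodular L M κ) (hB : #B < κ)
    {S S' : ImSort L M}
    {X : Set S.Elem} {Y : Set S'.Elem} (hX : IsTypeDef L B S.cls X) (hY : IsTypeDef L B S'.cls Y)
    {C₁ C₂ : Set (S.Elem × S'.Elem)} {k₁ l₁ k₂ l₂ : ℕ} (h₁ : IsUniform L B X Y C₁ k₁ l₁)
    (h₂ : IsUniform L B X Y C₂ k₂ l₂) : (k₁ : ℚ) / l₁ = k₂ / l₂ := by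
  obtain ⟨K, hKX, hKY, hKG, hKΓ, ⟨a₀, ha₀, hconn⟩, R₀, hR₀, hR₀K⟩ :=
    exists_finite_component_of_isUniform hω hM hB hX hY h₁ h₂
  have hCinv : ∀ p ∈ C₁ ∪ C₂, ∀ σ : autGroup L B, σ • p ∈ C₁ ∪ C₂ := by
    rintro p (hp | hp) σ
    · exact Or.inl (h₁.isTypeDef.smul_mem_pair σ hp)
    · exact Or.inr (h₂.isTypeDef.smul_mem_pair σ hp)
  have hcomm : ∀ x y, (x, y) ∈ C₁ ∪ C₂ →
      (stabilizer (autGroup L B) x).Commensurable (stabilizer (autGroup L B) y) := by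
    rintro x y (h | h)
    · exact h₁.commensurable h
    · exact h₂.commensurable h
  obtain ⟨w, hw₀, hwG, hwΓ⟩ := exists_weight (G := autGroup L B) hKG
    (by
      rintro _ _ (h | h) σ
      · exact .right (hCinv _ h σ)
      · exact .left (hCinv _ h σ))
    (by
      rintro _ _ (h | h)
      · rw [stabilizer_inl, stabilizer_inr]
        exact hcomm _ _ h
      · rw [stabilizer_inl, stabilizer_inr]
        exact (hcomm _ _ h).symm)
    hconn
    (by
      rintro (x | y) σ h
      · rw [Sum.smul_inl, stabilizer_inl, stabilizer_inl] at *
        exact hU.relIndex_eq hM hB x σ h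
      · rw [Sum.smul_inr, stabilizer_inr, stabilizer_inr] at *
        exact hU.relIndex_eq hM hB y σ h)
  have hKl : ∀ x ∈ (Sum.inl ⁻¹' K : Set S.Elem), ∀ σ : autGroup L B, σ • x ∈
      (Sum.inl ⁻¹' K : Set S.Elem) := fun x hx σ => hKG _ hx σ
  have hKr : ∀ y ∈ (Sum.inr ⁻¹' K : Set S'.Elem), ∀ σ : autGroup L B, σ • y ∈
      (Sum.inr ⁻¹' K : Set S'.Elem) := fun y hy σ => hKG _ hy σ
  obtain ⟨R, hR⟩ := exists_isTransversal hKl (hR₀.preimage Sum.inl_injective.injOn)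
    fun x hx => hR₀K _ hx
  obtain ⟨R', hR'⟩ := exists_isTransversal hKr (hR₀.preimage Sum.inr_injective.injOn)
    fun x hx => hR₀K _ hx
  have transport : ∀ C ⊆ C₁ ∪ C₂, ∀ k l, IsUniform L B X Y C k l →
      (∑ x ∈ R, w (Sum.inl x)) * k = (∑ y ∈ R', w (Sum.inr y)) * l := by
    intro C hC k l h
    refine mass_transport (fun _ hp σ => h.isTypeDef.smul_mem_pair σ hp) (fun p hp => ?_) hKl hR
      hR' (fun x hx => h.fibre_left x (hKX hx)) (fun y hy => h.fibre_right y (hKY hy))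
      (fun x => w (Sum.inl x)) (fun y => w (Sum.inr y)) (fun x hx σ => hwG _ hx σ)
      (fun y hy σ => hwG _ hy σ) fun p hp hpK => ?_
    · exact ⟨fun hx => hKΓ _ hx _ (.right (hC hp)), fun hy => hKΓ _ hy _ (.left (hC hp))⟩
    · have := hwΓ _ hpK _ (hKΓ _ hpK _ (.right (hC hp))) (.right (hC hp))
      rwa [stabilizer_inl, stabilizer_inr] at this
  have t₁ := transport C₁ Set.subset_union_left _ _ h₁
  have t₂ := transport C₂ Set.subset_union_right _ _ h₂
  have hl₁ : (l₁ : ℚ) ≠ 0 := Nat.cast_ne_zero.2 h₁.ne_zero_right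
  have hl₂ : (l₂ : ℚ) ≠ 0 := Nat.cast_ne_zero.2 h₂.ne_zero_right
  -- The base point may lie on either side. If it is in `Y`, then positivity there is carried over
  -- by `t₁`.
  have hpos : (∑ x ∈ R, w (Sum.inl x)) ≠ 0 := by
    rcases a₀ with x | y
    · obtain ⟨σ, hσ⟩ := hR.exists_mem x ha₀
      exact (Finset.sum_pos (fun z hz => hw₀ _ (hR.subset hz)) ⟨_, hσ⟩).ne'
    · obtain ⟨σ, hσ⟩ := hR'.exists_mem y ha₀
      have : 0 < ∑ y ∈ R', w (Sum.inr y) :=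
        Finset.sum_pos (fun z hz => hw₀ _ (hR'.subset hz)) ⟨_, hσ⟩
      intro h
      rw [h, zero_mul] at t₁
      exact mul_ne_zero this.ne' hl₁ t₁.symm
  rw [div_eq_div_iff hl₁ hl₂]
  refine mul_left_cancel₀ hpos ?_
  rw [← mul_assoc, ← mul_assoc, t₁, t₂]
  ring

variable {T : L.Theory}

theorem correspondenceUnimodularForTypes (hω : IsOmegaStable.{u, v, w} T)
    [Nonempty M] [T.Model M] (hM : IsMonster L M κ) (hU : Unimodular L M κ) :
    CorrespondenceUnimodularForTypes L M κ := by
  rintro S S' X Y ⟨A, hA, hX⟩ ⟨A', hA', hY⟩ A₁ A₂ hA₁ hA₂ C₁ C₂ k₁ l₁ k₂ l₂ h₁ h₂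
  have hadd : ∀ {A A' : Set (Meq L M)}, #A < κ → #A' < κ → #(A ∪ A' : Set (Meq L M)) < κ :=
    fun h h' => (mk_union_le _ _).trans_lt (add_lt_of_lt hM.uncountable.le h h')
  have hB := mk_repSet_lt hM.uncountable (hadd (hadd hA hA') (hadd hA₁ hA₂))
  exact hU.div_eq_div hω hM hB
    (hX.isTypeDef.mono (repSet_mono fun _ h => Or.inl (Or.inl h)))
    (hY.isTypeDef.mono (repSet_mono fun _ h => Or.inl (Or.inr h)))
    (h₁.isUniform (repSet_mono fun _ h => Or.inr (Or.inl h)))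
    (h₂.isUniform (repSet_mono fun _ h => Or.inr (Or.inr h)))

theorem RealDefinableOver.exists_finite {A : Set (Meq L M)} {ι : Type} {P : Set (ι → M)}
    (hP : RealDefinableOver A P) : ∃ A₀ : Set (Meq L M), A₀.Finite ∧ RealDefinableOver A₀ P := by
  obtain ⟨m, e, -, h⟩ := hP
  exact ⟨Set.range e, Set.finite_range e, m, e, Set.mem_range_self, h⟩

/-- The graph of a definable map with fibres of constant size is a uniform correspondence. -/
theorem IsDefinableMap.exists_isUniform {S S' : ImSort L M} {X : Set S.Elem} {Y : Set S'.Elem}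
    {f : S.Elem → S'.Elem} {k : ℕ} (hf : IsDefinableMap X Y f) (hk : HasFibreSize X Y f k)
    (hX : IsTypeDef L B S.cls X) (hY : IsTypeDef L B S'.cls Y) (hne : X.Nonempty) :
    ∃ A₀ : Set (Meq L M), A₀.Finite ∧ ∀ B', B ⊆ B' → repSet A₀ ⊆ B' →
      IsUniform L B' X Y {p | p.1 ∈ X ∧ f p.1 = p.2} 1 k := by
  obtain ⟨hmaps, D, hD, hDf⟩ := hf
  obtain ⟨A₀, hfin, hA₀⟩ := RealDefinableOver.exists_finite hD
  refine ⟨A₀, hfin, fun B' hB hB' => ⟨?_, ?_, ?_, ?_, ?_⟩⟩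
  · obtain ⟨x, hx⟩ := hne
    exact ⟨(x, f x), hx, rfl⟩
  · have h := ((hX.mono hB).fst (S' := S')).inter (((hY.mono hB).snd (S := S)).inter
      (isTypeDef_of_definable (hA₀.definable.mono hB')))
    convert! h using 1
    ext ⟨x, y⟩
    constructor
    · rintro ⟨hx, h⟩
      obtain rfl : f x = y := h
      exact ⟨hx, hmaps hx, (hDf x hx _ (hmaps hx)).2 rfl⟩
    · rintro ⟨hx, hy, h⟩
      exact ⟨hx, (hDf x hx y hy).1 h⟩
  · rintro ⟨x, y⟩ ⟨hx, h⟩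
    exact ⟨hx, (show f x = y from h) ▸ hmaps hx⟩
  · intro x hx
    have : {y | (x, y) ∈ {p : S.Elem × S'.Elem | p.1 ∈ X ∧ f p.1 = p.2}} = {f x} := by
      ext y
      exact ⟨fun h => h.2.symm, fun h => ⟨hx, h.symm⟩⟩
    rw [this, Set.encard_singleton, Nat.cast_one]
  · exact hk

theorem functionallyUnimodularForTypes (hω : IsOmegaStable.{u, v, w} T)
    [Nonempty M] [T.Model M] (hM : IsMonster L M κ) (hU : Unimodular L M κ) :
    FunctionallyUnimodularForTypes L M κ := by
  rintro S S' X Y ⟨A, hA, hX⟩ ⟨A', hA', hY⟩ ⟨y, hy⟩ f g k l hf hg hk hl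
  -- For empty `X` the graphs are empty, hence not uniform correspondences; here `Y` is non-empty
  -- and all fibres have size `0`.
  rcases X.eq_empty_or_nonempty with rfl | hne
  · have h₁ := hk y hy
    have h₂ := hl y hy
    simp only [Set.mem_empty_iff_false, false_and, Set.ofPred_false, Set.encard_empty] at h₁ h₂
    exact_mod_cast h₁.symm.trans h₂
  have hadd : ∀ {A A' : Set (Meq L M)}, #A < κ → #A' < κ → #(A ∪ A' : Set (Meq L M)) < κ :=
    fun h h' => (mk_union_le _ _).trans_lt (add_lt_of_lt hM.uncountable.le h h')
  have hX' := hX.isTypeDef.mono (repSet_mono (Set.subset_union_left (t := A')))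
  have hY' := hY.isTypeDef.mono (repSet_mono (Set.subset_union_right (s := A)))
  obtain ⟨A₁, hA₁, h₁⟩ := hf.exists_isUniform hk hX' hY' hne
  obtain ⟨A₂, hA₂, h₂⟩ := hg.exists_isUniform hl hX' hY' hne
  have hB := mk_repSet_lt hM.uncountable (hadd (hadd hA hA')
    (hadd (hA₁.lt_aleph0.trans hM.uncountable) (hA₂.lt_aleph0.trans hM.uncountable)))
  have hsub := repSet_mono (Set.subset_union_left (s := A ∪ A') (t := A₁ ∪ A₂))
  have h := hU.div_eq_div hω hM hB (hX'.mono hsub) (hY'.mono hsub)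
    (h₁ _ hsub (repSet_mono fun _ h => Or.inr (Or.inl h)))
    (h₂ _ hsub (repSet_mono fun _ h => Or.inr (Or.inr h)))
  simpa using h

/-- The diagonal of `X` is a uniform correspondence of ratio `1`, over the same parameters. -/
theorem allTypesMeasurable (hω : IsOmegaStable.{u, v, w} T)
    [Nonempty M] [T.Model M] (hM : IsMonster L M κ) (hU : Unimodular L M κ) :
    AllTypesMeasurable L M κ := by
  intro S X A hA hX A' hAA' hA' C k l hC
  have hB := mk_repSet_lt hM.uncountable hA'
  have hX' := hX.isTypeDef.mono (repSet_mono hAA')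
  have hdiag : IsUniform L (repSet A') X X {p | p.1 ∈ X ∧ p.1 = p.2} 1 1 := by
    refine ⟨?_, ?_, ?_, ?_, ?_⟩
    · obtain ⟨⟨x, y⟩, hp⟩ := hC.nonempty
      exact ⟨(x, x), (hC.subset hp).1, rfl⟩
    · exact (hX'.fst (S' := S)).inter (isTypeDef_of_definable
        (X := {p : S.Elem × S.Elem | p.1 = p.2})
        (definable_cls_eq _ S Sum.inl Sum.inr))
    · rintro ⟨x, y⟩ ⟨hx, h⟩
      exact ⟨hx, (show x = y from h) ▸ hx⟩
    · intro x hx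
      have : {y | (x, y) ∈ {p : S.Elem × S.Elem | p.1 ∈ X ∧ p.1 = p.2}} = {x} := by
        ext y
        exact ⟨fun h => h.2.symm, fun h => ⟨hx, h.symm⟩⟩
      rw [this, Set.encard_singleton, Nat.cast_one]
    · intro x hx
      have : {y | (y, x) ∈ {p : S.Elem × S.Elem | p.1 ∈ X ∧ p.1 = p.2}} = {x} := by
        ext y
        exact ⟨fun h => h.2, fun h => ⟨(show y = x from h) ▸ hx, h⟩⟩
      rw [this, Set.encard_singleton, Nat.cast_one]
  have hCu := hC.isUniform (B := repSet A') subset_rfl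
  have h := hU.div_eq_div hω hM hB hX' hX' hCu hdiag
  rw [Nat.cast_one, div_one, div_eq_one_iff_eq (Nat.cast_ne_zero.2 hCu.ne_zero_right)] at h
  exact_mod_cast h

end Main

end Unimod

theorem mainTheorem4 {L : FirstOrder.Language.{u, v}} (T : L.Theory) (hT : T.IsComplete)
    (hω : Unimod.IsOmegaStable.{u, v, w} T)
    (M : Type w) [L.Structure M] [Nonempty M] [T.Model M]
    (κ : Cardinal.{w}) (hM : Unimod.IsMonster L M κ)
    (hU : Unimod.Unimodular L M κ) :
    Unimod.CorrespondenceUnimodularForTypes L M κ ∧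
      Unimod.FunctionallyUnimodularForTypes L M κ ∧
      Unimod.AllTypesMeasurable L M κ :=
  ⟨Unimod.correspondenceUnimodularForTypes hω hM hU,
    Unimod.functionallyUnimodularForTypes hω hM hU, Unimod.allTypesMeasurable hω hM hU⟩
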